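/- Let $\mathcal X$ be a measurable space and $\mathcal Y=\{-1,+1\}$. A classifier is a measurable map $h:\mathcal X\to\mathcal Y$. Let $\mathbb C$ be a set of classifiers with $|\mathbb C|\ge 3$ and finite VC dimension $d$, i.e. $d$ is the largest $k$ such that some $(x_1,\dots,x_k)\in\mathcal X^k$ is shattered: for all $y\in\mathcal Y^k$ there is $h\in\mathbb C$ with $h(x_i)=y_i$ for all $i$. As a measurability assumption on $\mathbb C$, suppose that for all $k$ and $y\in\mathcal Y^k$ the set $\{x\in\mathcal X^k:\exists h\in\mathbb C\ \forall i\ h(x_i)=y_i\}$ is measurable. A learning algorithm maps every finite data set in $\mathcal X\times\mathcal Y$ to a classifier (not necessarily in $\mathbb C$), and may be randomized, with internal randomness independent of the data. For $\varepsilon,\delta\in(0,1)$ the sample complexity $\mathcal M(\varepsilon,\delta)\in\mathbb N\cup\{0,\infty\}$ is the smallest $m$ for which there is a learning algorithm such that, for every probability measure $P$ on $\mathcal X$ and every $f\in\mathbb C$, if $\hat h$ is its output on $(X_1,f(X_1)),\dots,(X_m,f(X_m))$ with $X_1,\dots,X_m$ independent of law $P$, then $P(x:\hat h(x)\ne f(x))\le\varepsilon$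 with probability at least $1-\delta$ (this event being measurable with respect to the completed measure); $\mathcal M(\varepsilon,\delta)=\infty$ if there is no such $m$. Put $\mathrm{Log}(z)=\ln(\max\{z,e\})$. Then $$\mathcal M(\varepsilon,\delta)=\Theta\left(\frac1\varepsilon\left(d+\mathrm{Log}\left(\frac1\delta\right)\right)\right)$$ with numerical constants: there are $\varepsilon_0,\delta_0\in(0,1)$ and $c_0\in(0,\infty)$, independent of $\mathcal X$, $\mathbb C$ (hence of $d$), such that for all such $\mathcal X,\mathbb C$ and all $\varepsilon\in(0,\varepsilon_0)$, $\delta\in(0,\delta_0)$, $$\mathcal M(\varepsilon,\delta)\le \frac{c_0}{\varepsilon}\left(d+\mathrm{Log}\left(\frac1\delta\right)\right)\quad\text{and}\quad \frac1\varepsilon\left(d+\mathrm{Log}\left(\frac1\delta\right)\right)\le c_0\,\mathcal M(\varepsilon,\delta).$$ -/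

import Mathlib

open MeasureTheory Set
open scoped ENNReal

universe u v

namespace PACLearning

/-- The label space `{-1, +1}` is represented by `Bool` (`true` is `+1`, `false` is `-1`).
A classifier is a measurable function `X → Bool`. The error rate of `h` with respect to the
target `f` is `P (x : h x ≠ f x)`. -/
def errorRate {X : Type u} [MeasurableSpace X] (P : Measure X) (h f : X → Bool) : ℝ≥0∞ :=
  P {x | h x ≠ f x}

/-- A (possibly randomized) learning algorithm: it maps a data set of any finite length,
together with the value `ω` of an internal random variable with law `μ`, to a classifier, which
need not belong to the concept space. A deterministic algorithm is the case where `Ω` is a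
one-point space. -/
structure LearningAlgorithm (X : Type u) [MeasurableSpace X] where
  /-- the space of values of the internal randomness -/
  Ω : Type v
  /-- its measurable sets -/
  [measurableSpace : MeasurableSpace Ω]
  /-- the law of the internal randomness -/
  μ : Measure Ω
  [isProbabilityMeasure : IsProbabilityMeasure μ]
  /-- the map from randomness and data to functions `X → {-1, +1}` -/
  run : Ω → (m : ℕ) → (Fin m → X × Bool) → X → Bool
  /-- the output is a classifier -/
  measurable_run : ∀ ω m S, Measurable (run ω m S)

attribute [instance] LearningAlgorithm.measurableSpace LearningAlgorithm.isProbabilityMeasure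

/-- The data set `((x₁, f x₁), …, (xₘ, f xₘ))`. -/
def labeled {X : Type u} (f : X → Bool) {m : ℕ} (x : Fin m → X) : Fin m → X × Bool :=
  fun i => (x i, f (x i))

/-- The event that the classifier learned from the labeled sample `x` of size `m`, with internal
randomness `ω`, has error rate at most `ε`. -/
def successEvent {X : Type u} [MeasurableSpace X] (A : LearningAlgorithm.{u, v} X) (m : ℕ) (ε : ℝ)
    (P : Measure X) (f : X → Bool) : Set (A.Ω × (Fin m → X)) :=
  {p | errorRate P (A.run p.1 m (labeled f p.2)) f ≤ ENNReal.ofReal ε}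

/-- With `m` samples, `A` is an `(ε, δ)`-PAC learner for `C`: for every data distribution `P` and
every target `f ∈ C`, the event that the learned classifier has error rate at most `ε` is
an event (measurable up to null sets) of probability at least `1 - δ`, where the data are
i.i.d. from `P` and independent of the internal randomness. -/
def IsPACLearner {X : Type u} [MeasurableSpace X] (C : Set (X → Bool)) (m : ℕ) (ε δ : ℝ)
    (A : LearningAlgorithm.{u, v} X) : Prop :=
  ∀ (P : Measure X) [IsProbabilityMeasure P], ∀ f ∈ C,
    NullMeasurableSet (successEvent A m ε P f) (A.μ.prod (Measure.pi fun _ : Fin m => P)) ∧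
    ENNReal.ofReal (1 - δ) ≤ (A.μ.prod (Measure.pi fun _ : Fin m => P)) (successEvent A m ε P f)

/-- The sample complexity of `(ε, δ)`-PAC learning: the smallest `m` for which some learning
algorithm is an `(ε, δ)`-PAC learner with `m` samples, and `⊤` if there is no such `m`. -/
noncomputable def sampleComplexity {X : Type u} [MeasurableSpace X] (C : Set (X → Bool))
    (ε δ : ℝ) : ℕ∞ :=
  ⨅ (m : ℕ) (_ : ∃ A : LearningAlgorithm.{u, v} X, IsPACLearner C m ε δ A), (m : ℕ∞)

/-- The labeling `y` of the sequence `x` is realized by some classifier in `C`. -/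
def Realizes {X : Type u} (C : Set (X → Bool)) {k : ℕ} (x : Fin k → X) (y : Fin k → Bool) : Prop :=
  ∃ h ∈ C, ∀ i, h (x i) = y i

/-- The sequence `x` is shattered by `C`. -/
def Shatters {X : Type u} (C : Set (X → Bool)) {k : ℕ} (x : Fin k → X) : Prop :=
  ∀ y : Fin k → Bool, Realizes C x y

/-- The Vapnik-Chervonenkis dimension: the largest length of a shattered sequence, `⊤` if there
is no largest one. -/
noncomputable def vcDim {X : Type u} (C : Set (X → Bool)) : ℕ∞ :=
  ⨆ (k : ℕ) (_ : ∃ x : Fin k → X, Shatters C x), (k : ℕ∞)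

/-- The measurability assumption on the concept space: for each finite sequence of labels, the
event that a sequence of data points can be given these labels by a classifier in `C` is
measurable. -/
def MeasurableRealizability {X : Type u} [MeasurableSpace X] (C : Set (X → Bool)) : Prop :=
  ∀ (k : ℕ) (y : Fin k → Bool), MeasurableSet {x : Fin k → X | Realizes C x y}

/-- The truncated logarithm `ln (max {z, e})`. -/
noncomputable def Log (z : ℝ) : ℝ := Real.log (max z (Real.exp 1))

end PACLearning

/-! Upper bound. Fix the one-inclusion graph predictor with leave-one-out bound `2 * d`, and let the
learner be the majority vote of the predictors trained on the prefixes that contain about half of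
the sample or more. If the vote errs at a point, at least half of its voters err there, so its error
rate is at most twice the average error rate of the voters, and it suffices to bound the sum of
these rates with an exponential tail.

Two exponential moments do this. Backwards in time, given the later points, the last point of a
prefix is exchangeable with the others, so the leave-one-out bound makes a mistake at index `t` have
conditional probability at most `2 * d / (t + 1)`; this bounds the moment of the number of mistakes
(`MistakeFamily.lintegral_prod_le`). Forwards in time, a supermartingale compares mistakes with
error rates (`MistakeFamily.lintegral_prod_mistakeWeight_le`). The product of the two integrands is
the exponential of half the sum of the error rates, and Markov's inequality for each gives the tail
`2 * exp (2 * d - ε * m / 16)`, with no logarithmic loss.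

Lower bound. Targets that agree on a sample but are more than `2 * ε` apart cannot both be learned
from it, so samples that allow such a pairing of targets have probability at most `2 * δ`
(`IsPACLearner.measure_le_of_pairing`). Two concepts that differ at a rare point give the term in
`δ`; a shattered sequence with one heavy and many light points gives the term in `d`. -/

namespace PACLearning

/-! ### The one-inclusion graph: edge density, peeling, and the leave-one-out predictor. -/

section OneInclusionGraph

/-- Edges of the one-inclusion graph in direction `a` split along another coordinate. -/
theorem card_edges_split {α : Type*} [DecidableEq α] (𝒜 : Finset (Finset α)) {a b : α}
    (hab : a ≠ b) :
    (𝒜.memberSubfamily a ∩ 𝒜.nonMemberSubfamily a).card =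
      ((𝒜.memberSubfamily b).memberSubfamily a ∩
        (𝒜.memberSubfamily b).nonMemberSubfamily a).card +
      ((𝒜.nonMemberSubfamily b).memberSubfamily a ∩
        (𝒜.nonMemberSubfamily b).nonMemberSubfamily a).card := by
  rw [← Finset.card_memberSubfamily_add_card_nonMemberSubfamily b]
  congr 2
  · ext s
    simp only [Finset.mem_memberSubfamily, Finset.mem_inter, Finset.mem_nonMemberSubfamily,
      Finset.mem_insert, Finset.insert_comm a b]
    grind
  · ext s
    simp only [Finset.mem_memberSubfamily, Finset.mem_inter, Finset.mem_nonMemberSubfamily,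
      Finset.mem_insert]
    grind

/-- An edge of either family is an edge of the union, and a common edge is an edge of the
intersection; then inclusion-exclusion. -/
theorem card_edges_add_le {α : Type*} [DecidableEq α] (𝒜 ℬ : Finset (Finset α)) (a : α) :
    (𝒜.memberSubfamily a ∩ 𝒜.nonMemberSubfamily a).card +
      (ℬ.memberSubfamily a ∩ ℬ.nonMemberSubfamily a).card ≤
    ((𝒜 ∪ ℬ).memberSubfamily a ∩ (𝒜 ∪ ℬ).nonMemberSubfamily a).card +
      ((𝒜 ∩ ℬ).memberSubfamily a ∩ (𝒜 ∩ ℬ).nonMemberSubfamily a).card := by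
  rw [← Finset.card_union_add_card_inter]
  refine Nat.add_le_add (Finset.card_le_card ?_) (Finset.card_le_card ?_) <;> intro s <;>
    simp only [Finset.mem_memberSubfamily, Finset.mem_inter, Finset.mem_nonMemberSubfamily,
      Finset.mem_union] <;> tauto

/-- Every member of the intersection extends to `𝒜` both with and without `b`, so the trace at `b`
is free. -/
theorem shatters_insert_of_inter {α : Type*} [DecidableEq α] {𝒜 : Finset (Finset α)} {b : α}
    {u : Finset α}
    (h : (𝒜.memberSubfamily b ∩ 𝒜.nonMemberSubfamily b).Shatters u) :
    𝒜.Shatters (insert b u) := by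
  intro t ht
  obtain ⟨w, hw, hwt⟩ := h (t := t.erase b) (by grind)
  simp only [Finset.mem_inter, Finset.mem_memberSubfamily, Finset.mem_nonMemberSubfamily] at hw
  by_cases hbt : b ∈ t
  · refine ⟨insert b w, hw.1.1, ?_⟩
    rw [← Finset.insert_inter_distrib, hwt, Finset.insert_erase hbt]
  · refine ⟨w, hw.2.1, ?_⟩
    rw [Finset.insert_inter_of_notMem hw.1.2, hwt, Finset.erase_eq_of_notMem hbt]

theorem shatters_of_union {α : Type*} [DecidableEq α] {𝒜 : Finset (Finset α)} {b : α}
    {u : Finset α} (hb : b ∉ u)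
    (h : (𝒜.memberSubfamily b ∪ 𝒜.nonMemberSubfamily b).Shatters u) :
    𝒜.Shatters u := by
  intro t ht
  obtain ⟨w, hw, hwt⟩ := h ht
  simp only [Finset.mem_union, Finset.mem_memberSubfamily, Finset.mem_nonMemberSubfamily] at hw
  rcases hw with hw | hw
  · exact ⟨_, hw.1, by rw [Finset.inter_insert_of_notMem hb, hwt]⟩
  · exact ⟨_, hw.1, hwt⟩

/-- The edge density of the one-inclusion graph is at most the VC dimension. -/
theorem sum_card_edges_le {α : Type*} [DecidableEq α] (s : Finset α) :
    ∀ (d : ℕ) (𝒜 : Finset (Finset α)), (∀ u ⊆ s, 𝒜.Shatters u → u.card ≤ d) →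
      ∑ a ∈ s, (𝒜.memberSubfamily a ∩ 𝒜.nonMemberSubfamily a).card ≤ d * 𝒜.card := by
  induction s using Finset.induction_on with
  | empty => simp
  | insert b s hb ih =>
    intro d 𝒜 h
    -- `ℐ` is the set of edges in direction `b` and `𝒰` the projection of `𝒜` along `b`. Their
    -- cardinalities add up to that of `𝒜`, and `ℐ` shatters one coordinate fewer, which pays for
    -- the edges in direction `b`.
    set ℐ := 𝒜.memberSubfamily b ∩ 𝒜.nonMemberSubfamily b with hℐ
    set 𝒰 := 𝒜.memberSubfamily b ∪ 𝒜.nonMemberSubfamily b with h𝒰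
    have hI : ∀ u ⊆ s, ℐ.Shatters u → u.card + 1 ≤ d := fun u hu hs => by
      have hbu : b ∉ u := fun hx => hb (hu hx)
      have := h (insert b u) (Finset.insert_subset_insert _ hu) (shatters_insert_of_inter hs)
      rwa [Finset.card_insert_of_notMem hbu] at this
    have hU := ih d 𝒰 fun u hu hs =>
      h u (hu.trans (Finset.subset_insert _ _)) (shatters_of_union (fun hx => hb (hu hx)) hs)
    have hI2 := ih (d - 1) ℐ fun u hu hs => Nat.le_sub_one_of_lt (hI u hu hs)
    have hcard : 𝒜.card = 𝒰.card + ℐ.card := by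
      rw [h𝒰, hℐ, Finset.card_union_add_card_inter,
        Finset.card_memberSubfamily_add_card_nonMemberSubfamily]
    -- The subtraction truncates only for `d = 0`; then `ℐ` is empty, because a nonempty family
    -- shatters `∅`.
    have hI3 : (d - 1) * ℐ.card + ℐ.card ≤ d * ℐ.card := by
      rcases ℐ.eq_empty_or_nonempty with h0 | h0
      · simp [h0]
      · have := hI ∅ (by simp) (by simpa using h0)
        obtain ⟨e, rfl⟩ : ∃ e, d = e + 1 := ⟨d - 1, by simp at this; omega⟩
        simp [Nat.add_mul]
    rw [Finset.sum_insert hb]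
    have hsum : ∑ a ∈ s, (𝒜.memberSubfamily a ∩ 𝒜.nonMemberSubfamily a).card ≤
        ∑ a ∈ s, ((𝒰.memberSubfamily a ∩ 𝒰.nonMemberSubfamily a).card +
          (ℐ.memberSubfamily a ∩ ℐ.nonMemberSubfamily a).card) := by
      refine Finset.sum_le_sum fun a ha => ?_
      rw [card_edges_split 𝒜 (show a ≠ b from fun hx => hb (hx ▸ ha))]
      exact card_edges_add_le _ _ _
    rw [Finset.sum_add_distrib] at hsum
    rw [hcard, Nat.mul_add, ← hℐ]
    omega

variable {ι : Type*} [Fintype ι] [DecidableEq ι]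

/-- The neighbour of `v` in direction `i` of the hypercube. -/
def flip (v : ι → Bool) (i : ι) : ι → Bool := Function.update v i (!v i)

open Classical in
/-- The degree of `v` in the one-inclusion graph of `V`. -/
noncomputable def degree (V : Set (ι → Bool)) (v : ι → Bool) : ℕ :=
  (Finset.univ.filter fun i => flip v i ∈ V).card

/-- No labeling class `V` shatters more than `d` coordinates. -/
def VCLE (V : Set (ι → Bool)) (d : ℕ) : Prop :=
  ∀ u : Finset ι, (∀ y : ι → Bool, ∃ v ∈ V, ∀ i ∈ u, v i = y i) → u.card ≤ d

omit [Fintype ι] [DecidableEq ι] in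
theorem VCLE.mono {V W : Set (ι → Bool)} {d : ℕ} (h : VCLE V d) (hW : W ⊆ V) : VCLE W d :=
  fun u hu => h u fun y => (hu y).imp fun _ hv => ⟨hW hv.1, hv.2⟩

/-- The support of a labeling. -/
def support (v : ι → Bool) : Finset ι := Finset.univ.filter fun i => v i = true

omit [DecidableEq ι] in
theorem mem_support {v : ι → Bool} {i : ι} : i ∈ support v ↔ v i = true := by simp [support]

omit [DecidableEq ι] in
theorem support_injective : Function.Injective (support (ι := ι)) := by
  intro v w h
  funext i
  have : i ∈ support v ↔ i ∈ support w := by rw [h]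
  rw [mem_support, mem_support] at this
  exact Bool.eq_iff_iff.2 this

/-- The average degree is twice the edge density, hence at most `2 * d`. -/
theorem exists_degree_le {V : Set (ι → Bool)} {d : ℕ} (hV : VCLE V d) (hne : V.Nonempty) :
    ∃ v ∈ V, degree V v ≤ 2 * d := by
  classical
  by_contra! hcon
  set F : Finset (ι → Bool) := Finset.univ.filter (· ∈ V) with hF
  have hmemF : ∀ v, v ∈ F ↔ v ∈ V := by simp [hF]
  set 𝒜 := F.image support with h𝒜
  have hcard : 𝒜.card = F.card := Finset.card_image_of_injective _ support_injective
  have hedge := sum_card_edges_le Finset.univ d 𝒜 (by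
    intro u _ hu
    refine hV u fun y => ?_
    obtain ⟨w, hw, hwu⟩ := hu (t := u.filter fun i => y i = true) (Finset.filter_subset _ _)
    obtain ⟨v, hv, rfl⟩ := Finset.mem_image.1 hw
    refine ⟨v, (hmemF v).1 hv, fun i hi => ?_⟩
    have : i ∈ u ∩ support v ↔ i ∈ u.filter fun i => y i = true := by rw [hwu]
    simp only [Finset.mem_inter, hi, true_and, mem_support, Finset.mem_filter] at this
    exact Bool.eq_iff_iff.2 this)
  -- Each edge in direction `i` has two endpoints, told apart by the label at `i`; each class of
  -- endpoints injects into the edges.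
  have hdir : ∀ i, (F.filter fun v => flip v i ∈ V).card ≤
      2 * (𝒜.memberSubfamily i ∩ 𝒜.nonMemberSubfamily i).card := by
    intro i
    rw [two_mul, ← Finset.card_filter_add_card_filter_not (fun v : ι → Bool => v i = true)]
    refine Nat.add_le_add ?_ ?_
    · refine Finset.card_le_card_of_injOn (fun v => support (flip v i)) ?_ ?_
      · intro v hv
        simp only [Finset.coe_filter, mem_ofPred_eq, Finset.mem_filter] at hv
        simp only [Finset.coe_inter, mem_inter_iff, Finset.mem_coe, Finset.mem_memberSubfamily,
          Finset.mem_nonMemberSubfamily]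
        have hn : i ∉ support (flip v i) := by simp [mem_support, flip, hv.2]
        refine ⟨⟨?_, hn⟩, ?_, hn⟩
        · have : insert i (support (flip v i)) = support v := by
            ext j
            by_cases hj : j = i
            · subst hj; simp [mem_support, hv.2]
            · simp [mem_support, flip, hj]
          rw [this]
          exact Finset.mem_image_of_mem _ hv.1.1
        · exact Finset.mem_image_of_mem _ ((hmemF _).2 hv.1.2)
      · intro v hv w hw h
        simp only [Finset.coe_filter, mem_ofPred_eq, Finset.mem_filter] at hv hw
        have := support_injective h
        funext j
        by_cases hj : j = i
        · subst hj; rw [hv.2, hw.2]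
        · simpa [flip, hj] using congrFun this j
    · refine Finset.card_le_card_of_injOn support ?_ (support_injective.injOn)
      intro v hv
      simp only [Finset.coe_filter, mem_ofPred_eq, Finset.mem_filter] at hv
      simp only [Finset.coe_inter, mem_inter_iff, Finset.mem_coe, Finset.mem_memberSubfamily,
          Finset.mem_nonMemberSubfamily]
      have hn : i ∉ support v := by rw [mem_support]; exact hv.2
      refine ⟨⟨?_, hn⟩, Finset.mem_image_of_mem _ hv.1.1, hn⟩
      have : insert i (support v) = support (flip v i) := by
        ext j
        by_cases hj : j = i
        · subst hj; simpa [mem_support, flip] using hv.2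
        · simp [mem_support, flip, hj]
      rw [this]
      exact Finset.mem_image_of_mem _ ((hmemF _).2 hv.1.2)
  have hsum : ∑ v ∈ F, degree V v = ∑ i, (F.filter fun v => flip v i ∈ V).card := by
    simp only [degree, Finset.card_filter]
    exact Finset.sum_comm
  have hlow : F.card * (2 * d + 1) ≤ ∑ v ∈ F, degree V v := by
    rw [← smul_eq_mul]
    exact Finset.card_nsmul_le_sum _ _ _ fun v hv => hcon v ((hmemF v).1 hv)
  have hup : ∑ v ∈ F, degree V v ≤ 2 * (d * F.card) := by
    rw [hsum, ← hcard]
    refine (Finset.sum_le_sum fun i _ => hdir i).trans ?_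
    rw [← Finset.mul_sum]
    exact Nat.mul_le_mul_left 2 hedge
  have hpos : 0 < F.card := by
    obtain ⟨v, hv⟩ := hne
    exact Finset.card_pos.2 ⟨v, (hmemF v).2 hv⟩
  have : F.card * (2 * d + 1) = 2 * (d * F.card) + F.card := by ring
  omega

/-- Successive peeling of the one-inclusion graph: at each stage all vertices of degree at most
`D` are removed. -/
def core (D : ℕ) (V : Set (ι → Bool)) : ℕ → Set (ι → Bool)
  | 0 => V
  | k + 1 => {v | v ∈ core D V k ∧ D < degree (core D V k) v}

theorem core_antitone (D : ℕ) (V : Set (ι → Bool)) : Antitone (core D V) :=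
  antitone_nat_of_succ_le fun _ _ hv => hv.1

/-- Subclasses inherit the VC bound, so each nonempty stage has a vertex of degree at most `2 * d`
and shrinks strictly. -/
theorem exists_core_eq_empty {V : Set (ι → Bool)} {d : ℕ} (hV : VCLE V d) :
    ∃ k, core (2 * d) V k = ∅ := by
  by_contra! hcon
  have hlt : ∀ k, (core (2 * d) V (k + 1)).ncard < (core (2 * d) V k).ncard := by
    intro k
    refine Set.ncard_lt_ncard ?_ (Set.toFinite _)
    refine ⟨core_antitone _ _ (Nat.le_succ k), fun hsub => ?_⟩
    obtain ⟨v, hv, hdeg⟩ := exists_degree_le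
      (hV.mono (core_antitone (2 * d) V (Nat.zero_le k))) (hcon k)
    exact absurd (hsub hv).2 (not_lt.2 hdeg)
  exact not_strictAnti_of_wellFoundedLT _
    (strictAnti_nat_of_succ_lt (f := fun k => (core (2 * d) V k).ncard) hlt)

/-- The label predicted for coordinate `i` from the labels `v` of all other coordinates: the
completion which survives the peeling longer. -/
noncomputable def guess (D : ℕ) (V : Set (ι → Bool)) (v : ι → Bool) (i : ι) : Bool :=
  open Classical in
  decide (∃ k, Function.update v i true ∈ core D V k ∧ Function.update v i false ∉ core D V k)

theorem guess_update (D : ℕ) (V : Set (ι → Bool)) (v : ι → Bool) (i : ι) (b : Bool) :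
    guess D V (Function.update v i b) i = guess D V v i := by
  simp [guess]

/-- The leave-one-out bound for the one-inclusion graph predictor. -/
theorem card_guess_ne_le {V : Set (ι → Bool)} {d : ℕ} (hV : VCLE V d) {v : ι → Bool}
    (hv : v ∈ V) : (Finset.univ.filter fun i => guess (2 * d) V v i ≠ v i).card ≤ 2 * d := by
  classical
  -- At the stage where `v` is removed it has at most `2 * d` neighbours left. A wrong guess at `i`
  -- forces the neighbour in direction `i` to be still present, so the mistakes inject into these
  -- neighbours.
  obtain ⟨k, hk, hk'⟩ : ∃ k, v ∈ core (2 * d) V k ∧ v ∉ core (2 * d) V (k + 1) := by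
    by_contra! hcon
    obtain ⟨k, hk⟩ := exists_core_eq_empty hV
    have : ∀ k, v ∈ core (2 * d) V k := fun k => by
      induction k with
      | zero => exact hv
      | succ k ih => exact hcon k ih
    simpa [hk] using this k
  have hdeg : degree (core (2 * d) V k) v ≤ 2 * d := by
    by_contra! hlt
    exact hk' ⟨hk, hlt⟩
  refine le_trans (Finset.card_le_card ?_) hdeg
  intro i
  simp only [Finset.mem_filter, Finset.mem_univ, true_and]
  contrapose!
  intro hflip
  have hupd : Function.update v i (v i) = v := Function.update_eq_self i v
  unfold flip at hflip
  cases hvi : v i with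
  | true =>
    rw [hvi] at hupd hflip
    simp only [guess, decide_eq_true_eq]
    exact ⟨k, by rwa [hupd], hflip⟩
  | false =>
    rw [hvi] at hupd hflip
    simp only [guess, decide_eq_false_iff_not]
    rintro ⟨j, hj, hj'⟩
    rw [hupd] at hj'
    rcases le_total j k with h | h
    · exact hj' (core_antitone _ _ h hk)
    · exact hflip (core_antitone _ _ h hj)

variable {V V' : Set (ι → Bool)} {e : ι ≃ ι}

omit [Fintype ι] in
theorem update_comp_perm (v : ι → Bool) (e : ι ≃ ι) (i : ι) (b : Bool) :
    Function.update (v ∘ e) i b = Function.update v (e i) b ∘ e := by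
  rw [Function.update_comp_equiv, Equiv.symm_apply_apply]

omit [Fintype ι] in
theorem flip_comp (v : ι → Bool) (e : ι ≃ ι) (i : ι) : flip (v ∘ e) i = flip v (e i) ∘ e :=
  update_comp_perm v e i _

/-- All vertices of low degree are peeled at once, without arbitrary choices, so the peeling
commutes with relabeling the coordinates. This is what makes the predictor symmetric. -/
theorem mem_core_comp (D : ℕ) (h : ∀ v, v ∘ e ∈ V' ↔ v ∈ V) (k : ℕ) :
    ∀ v, v ∘ e ∈ core D V' k ↔ v ∈ core D V k := by
  classical
  induction k with
  | zero => exact h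
  | succ k ih =>
    intro v
    have hdeg : degree (core D V' k) (v ∘ e) = degree (core D V k) v := by
      unfold degree
      refine Finset.card_equiv e fun i => ?_
      rw [Finset.mem_filter, Finset.mem_filter, flip_comp, ih]
      simp
    simp only [core, mem_ofPred_eq, ih, hdeg]

/-- The one-inclusion graph predictor is equivariant under permutations of the coordinates. -/
theorem guess_comp (D : ℕ) (h : ∀ v, v ∘ e ∈ V' ↔ v ∈ V) (v : ι → Bool) (i : ι) :
    guess D V' (v ∘ e) i = guess D V v (e i) := by
  unfold guess
  congr 1
  simp_rw [update_comp_perm, mem_core_comp D h]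

end OneInclusionGraph

/-! ### Exponential tails for the summed error rates of a symmetric predictor. -/

section PrefixMistakes

variable {X : Type u} [MeasurableSpace X] {m : ℕ}

theorem indicator_one_congr {α : Type*} {s : Set α} {x y : α} (h : x ∈ s ↔ y ∈ s) :
    s.indicator (1 : α → ℝ≥0∞) x = s.indicator 1 y := by
  by_cases hx : x ∈ s
  · rw [indicator_of_mem hx, indicator_of_mem (h.1 hx)]; rfl
  · rw [indicator_of_notMem hx, indicator_of_notMem fun h' => hx (h.2 h')]

theorem measurePreserving_comp_swap (P : Measure X) [IsProbabilityMeasure P] (i j : Fin m) :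
    MeasurePreserving (fun x : Fin m → X => x ∘ Equiv.swap i j)
      (Measure.pi fun _ => P) (Measure.pi fun _ => P) := by
  have h := measurePreserving_piCongrLeft (fun _ : Fin m => P) (Equiv.swap i j)
  convert h using 1
  funext x k
  have := MeasurableEquiv.piCongrLeft_apply_apply (β := fun _ : Fin m => X) (Equiv.swap i j) x
    (Equiv.swap i j k)
  rw [Equiv.swap_apply_self] at this
  exact this.symm

/-- A family of events `Mis t`, "the label of the point number `t` is predicted wrongly from the
points before it", with the symmetry and the leave-one-out bound `D` of a predictor which does not
depend on the order of its data. -/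
structure MistakeFamily (Mis : Fin m → Set (Fin m → X)) (D : ℕ) : Prop where
  measurableSet : ∀ t, MeasurableSet (Mis t)
  congr : ∀ t x y, (∀ i ≤ t, x i = y i) → (x ∈ Mis t ↔ y ∈ Mis t)
  swap_mem : ∀ s t j x, s < t → j ≤ s → (x ∘ Equiv.swap j s ∈ Mis t ↔ x ∈ Mis t)
  sum_le : ∀ t x, ∑ j ∈ Finset.Iic t, (Mis t).indicator 1 (x ∘ Equiv.swap j t) ≤ (D : ℝ≥0∞)

/-- The error rate of the predictor based on the points before `t`. -/
noncomputable def prefixError (P : Measure X) (Mis : Fin m → Set (Fin m → X)) (t : Fin m)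
    (x : Fin m → X) : ℝ≥0∞ :=
  P {z | Function.update x t z ∈ Mis t}

variable {Mis : Fin m → Set (Fin m → X)} {D : ℕ} (P : Measure X) [IsProbabilityMeasure P]

theorem MistakeFamily.measurable_prefixError (h : MistakeFamily Mis D) (t : Fin m) :
    Measurable (prefixError P Mis t) :=
  measurable_measure_prodMk_left (measurable_update' (h.measurableSet t))

omit [IsProbabilityMeasure P] in
theorem prefixError_update (t : Fin m) (x : Fin m → X) (z : X) :
    prefixError P Mis t (Function.update x t z) = prefixError P Mis t x := by
  simp [prefixError]

omit [IsProbabilityMeasure P] in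
theorem MistakeFamily.prefixError_update_of_lt (h : MistakeFamily Mis D) {s t : Fin m}
    (hst : s < t) (x : Fin m → X) (z : X) :
    prefixError P Mis s (Function.update x t z) = prefixError P Mis s x := by
  unfold prefixError
  congr 1
  ext y
  refine h.congr s _ _ fun i hi => ?_
  have : i ≠ t := (hi.trans_lt hst).ne
  by_cases his : i = s
  · subst his; simp
  · simp [his, this]

/-- Exponential moment of the number of mistakes: the last point of each prefix is uniformly
distributed among the points of the prefix, given the later points. -/
theorem MistakeFamily.lintegral_prod_le (h : MistakeFamily Mis D) {q : ℝ≥0∞} (T : Finset (Fin m))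
    (hq : ∀ t ∈ T, (D : ℝ≥0∞) ≤ q * ((t : ℕ) + 1 : ℕ)) :
    ∫⁻ x, ∏ t ∈ T, (1 + (Mis t).indicator 1 x) ∂(Measure.pi fun _ => P) ≤ (1 + q) ^ T.card := by
  -- The smallest index is split off: factors with larger index are invariant under permutations of
  -- the points up to `a`, so the factor at `a` may be averaged over the swaps of `a` with each `j ≤
  -- a`.
  induction T using Finset.induction_on_min with
  | empty => simp
  | insert a s has ih =>
    have hns : a ∉ s := fun hx => lt_irrefl _ (has a hx)
    have ih := ih fun t ht => hq t (Finset.mem_insert_of_mem ht)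
    rw [Finset.card_insert_of_notMem hns, pow_succ']
    simp only [Finset.prod_insert hns]
    set G : (Fin m → X) → ℝ≥0∞ := fun x => ∏ t ∈ s, (1 + (Mis t).indicator 1 x) with hG
    have hmi : ∀ t, Measurable fun x : Fin m → X => (1 + (Mis t).indicator 1 x : ℝ≥0∞) := fun t =>
      (measurable_one.indicator (h.measurableSet t)).const_add 1
    have hGm : Measurable G := Finset.measurable_fun_prod _ fun t _ => hmi t
    have hGs : ∀ j ∈ Finset.Iic a, ∀ x, G (x ∘ Equiv.swap j a) = G x := by
      intro j hj x
      refine Finset.prod_congr rfl fun t ht => ?_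
      congr 1
      have := h.swap_mem a t j x (has t ht) (Finset.mem_Iic.1 hj)
      exact indicator_one_congr this
    have hcard : ((Finset.Iic a).card : ℝ≥0∞) = ((a : ℕ) + 1 : ℕ) := by simp
    have hkey : ((a : ℕ) + 1 : ℕ) * ∫⁻ x, (1 + (Mis a).indicator 1 x) * G x ∂(Measure.pi fun _ => P)
        ≤ ((a : ℕ) + 1 : ℕ) * ((1 + q) * ∫⁻ x, G x ∂(Measure.pi fun _ => P)) := by
      calc ((a : ℕ) + 1 : ℕ) * ∫⁻ x, (1 + (Mis a).indicator 1 x) * G x ∂(Measure.pi fun _ => P)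
          = ∑ j ∈ Finset.Iic a,
              ∫⁻ x, (1 + (Mis a).indicator 1 (x ∘ Equiv.swap j a)) * G x
                ∂(Measure.pi fun _ => P) := by
            rw [← hcard, ← nsmul_eq_mul, ← Finset.sum_const]
            refine Finset.sum_congr rfl fun j hj => ?_
            rw [← (measurePreserving_comp_swap P j a).lintegral_comp
              (show Measurable fun x => (1 + (Mis a).indicator 1 x) * G x from (hmi a).mul hGm)]
            simp only [hGs j hj]
        _ = ∫⁻ x, (∑ j ∈ Finset.Iic a, (1 + (Mis a).indicator 1 (x ∘ Equiv.swap j a))) * G x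
                ∂(Measure.pi fun _ => P) := by
            rw [← lintegral_finsetSum]
            · simp only [Finset.sum_mul]
            · exact fun j _ =>
                ((hmi a).comp (measurePreserving_comp_swap P j a).measurable).mul hGm
        _ ≤ ∫⁻ x, (((a : ℕ) + 1 : ℕ) * (1 + q)) * G x ∂(Measure.pi fun _ => P) := by
            refine lintegral_mono fun x => mul_le_mul_left ?_ _
            rw [Finset.sum_add_distrib, Finset.sum_const, nsmul_eq_mul, hcard, mul_one, mul_add,
              mul_one, mul_comm _ q]
            exact add_le_add_right ((h.sum_le a x).trans (hq a (Finset.mem_insert_self _ _))) _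
        _ = _ := by rw [lintegral_const_mul _ hGm, mul_assoc]
    rw [ENNReal.mul_le_mul_iff_right (by simp) (ENNReal.natCast_ne_top _)] at hkey
    exact hkey.trans (by gcongr)

/-- `exp (e / 2)`, as a function of an error rate. -/
noncomputable def expHalf (e : ℝ≥0∞) : ℝ≥0∞ := ENNReal.ofReal (Real.exp (e.toReal / 2))

theorem measurable_expHalf : Measurable expHalf :=
  (Real.measurable_exp.comp (ENNReal.measurable_toReal.div_const 2)).ennreal_ofReal

/-- This is the supermartingale step: `1 - e / 2` is the conditional mean of the mistake factor when
the error rate is `e`. -/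
theorem one_sub_half_mul_expHalf_le {e : ℝ≥0∞} (he : e ≤ 1) : (1 - e / 2) * expHalf e ≤ 1 := by
  lift e to NNReal using ne_top_of_le_ne_top ENNReal.one_ne_top he
  have he' : (e : ℝ) ≤ 1 := by exact_mod_cast he
  have h1 : (1 - (e : ℝ≥0∞) / 2) = ENNReal.ofReal (1 - e / 2) := by
    rw [ENNReal.ofReal_sub _ (by positivity), ENNReal.ofReal_one,
      ENNReal.ofReal_div_of_pos (by norm_num)]
    simp
  rw [h1, expHalf, ← ENNReal.ofReal_mul (by linarith [e.2])]
  refine ENNReal.ofReal_le_one.2 ?_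
  have h2 : 1 - (e : ℝ) / 2 ≤ Real.exp (-(e / 2)) := by
    have := Real.add_one_le_exp (-((e : ℝ) / 2)); linarith
  calc (1 - (e : ℝ) / 2) * Real.exp ((e : ℝ≥0∞).toReal / 2)
      ≤ Real.exp (-(e / 2)) * Real.exp ((e : ℝ≥0∞).toReal / 2) := by gcongr
    _ = 1 := by rw [← Real.exp_add]; simp

/-- The factors of a supermartingale which compares mistakes with error rates. -/
noncomputable def mistakeWeight (P : Measure X) (Mis : Fin m → Set (Fin m → X)) (t : Fin m)
    (x : Fin m → X) : ℝ≥0∞ :=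
  (1 - (Mis t).indicator 1 x / 2) * expHalf (prefixError P Mis t x)

theorem MistakeFamily.measurable_mistakeWeight (h : MistakeFamily Mis D) (t : Fin m) :
    Measurable (mistakeWeight P Mis t) :=
  (measurable_const.sub ((measurable_one.indicator (h.measurableSet t)).div_const 2)).mul
    (measurable_expHalf.comp (h.measurable_prefixError P t))

theorem MistakeFamily.lintegral_prod_mistakeWeight_le (h : MistakeFamily Mis D)
    (T : Finset (Fin m)) :
    ∫⁻ x, ∏ t ∈ T, mistakeWeight P Mis t x ∂(Measure.pi fun _ => P) ≤ 1 := by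
  -- Here the largest index is split off: earlier factors do not depend on the point `a`, which is
  -- integrated out alone.
  induction T using Finset.induction_on_max with
  | empty => simp
  | insert a s has ih =>
    have hns : a ∉ s := fun hx => lt_irrefl _ (has a hx)
    simp only [Finset.prod_insert hns]
    refine le_trans ?_ ih
    have hFm : Measurable fun x => ∏ t ∈ s, mistakeWeight P Mis t x :=
      Finset.measurable_fun_prod _ fun t _ => h.measurable_mistakeWeight P t
    refine lintegral_le_of_lmarginal_le {a} ((h.measurable_mistakeWeight P a).mul hFm) hFm ?_
    intro x
    rw [lmarginal_singleton, lmarginal_singleton]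
    have hF : ∀ z, ∏ t ∈ s, mistakeWeight P Mis t (Function.update x a z) =
        ∏ t ∈ s, mistakeWeight P Mis t x := by
      intro z
      refine Finset.prod_congr rfl fun t ht => ?_
      have hta := has t ht
      unfold mistakeWeight
      rw [h.prefixError_update_of_lt P hta]
      have : Function.update x a z ∈ Mis t ↔ x ∈ Mis t := h.congr t _ _ fun i hi => by
        simp [(hi.trans_lt hta).ne]
      rw [indicator_one_congr this]
    simp only [hF, lintegral_const, measure_univ, mul_one]
    set B : Set X := {z | Function.update x a z ∈ Mis a} with hB
    have hBm : MeasurableSet B := measurable_update x (h.measurableSet a)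
    have hw : ∀ z, mistakeWeight P Mis a (Function.update x a z) =
        (1 - B.indicator 1 z / 2) * expHalf (P B) := by
      intro z
      unfold mistakeWeight
      rw [prefixError_update]
      rfl
    have hBi : Measurable fun z : X => B.indicator (1 : X → ℝ≥0∞) z / 2 :=
      (measurable_one.indicator hBm).div_const 2
    have hle : ∀ z : X, B.indicator (1 : X → ℝ≥0∞) z / 2 ≤ 1 := by
      intro z
      by_cases hz : z ∈ B <;> simp [hz]
    have hint : ∫⁻ z, B.indicator (1 : X → ℝ≥0∞) z / 2 ∂P = P B / 2 := by
      simp only [div_eq_mul_inv]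
      rw [lintegral_mul_const _ (measurable_one.indicator hBm), lintegral_indicator_one hBm]
    calc ∫⁻ z, mistakeWeight P Mis a (Function.update x a z) *
          ∏ t ∈ s, mistakeWeight P Mis t x ∂P
        = ∫⁻ z, (1 - B.indicator (1 : X → ℝ≥0∞) z / 2) *
            (expHalf (P B) * ∏ t ∈ s, mistakeWeight P Mis t x) ∂P := by
          simp only [hw, mul_assoc]
      _ = (1 - P B / 2) * (expHalf (P B) * ∏ t ∈ s, mistakeWeight P Mis t x) := by
          rw [lintegral_mul_const _ (hBi.const_sub 1), lintegral_sub hBi, hint]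
          · simp
          · rw [hint]
            exact ne_top_of_le_ne_top (b := 1) (by simp)
              (ENNReal.div_le_of_le_mul (by
                calc P B ≤ 1 := prob_le_one
                  _ ≤ 1 * 2 := by norm_num))
          · exact Filter.Eventually.of_forall hle
      _ ≤ 1 * ∏ t ∈ s, mistakeWeight P Mis t x := by
          rw [← mul_assoc]
          exact mul_le_mul_left (one_sub_half_mul_expHalf_le prob_le_one) _
      _ = _ := one_mul _

omit [IsProbabilityMeasure P] in
-- On a mistake the factors `1 / 2` and `2` cancel, otherwise both are `1`; only the exponentials of
-- the error rates remain.
theorem prod_mistakeWeight_mul_prod (T : Finset (Fin m)) (x : Fin m → X) :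
    (∏ t ∈ T, mistakeWeight P Mis t x) * ∏ t ∈ T, (1 + (Mis t).indicator 1 x) =
      ENNReal.ofReal (Real.exp ((∑ t ∈ T, (prefixError P Mis t x).toReal) / 2)) := by
  rw [← Finset.prod_mul_distrib, Finset.sum_div, Real.exp_sum,
    ENNReal.ofReal_prod_of_nonneg fun _ _ => (Real.exp_pos _).le]
  refine Finset.prod_congr rfl fun t _ => ?_
  unfold mistakeWeight
  rw [mul_right_comm]
  rw [← expHalf]
  convert one_mul _
  by_cases hx : x ∈ Mis t
  · rw [indicator_of_mem hx, Pi.one_apply, ← inv_eq_one_div, ENNReal.one_sub_inv_two,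
      one_add_one_eq_two, ENNReal.inv_mul_cancel (by simp) (by simp)]
  · rw [indicator_of_notMem hx]; simp

/-- The sum of the error rates of the prefix predictors has exponential tails. -/
theorem MistakeFamily.measure_sum_prefixError_ge_le (h : MistakeFamily Mis D) {q c S : ℝ}
    (hq0 : 0 ≤ q) (T : Finset (Fin m)) (hq : ∀ t ∈ T, (D : ℝ) ≤ q * ((t : ℕ) + 1))
    (hc : q * T.card ≤ 2 * c) :
    (Measure.pi fun _ => P) {x | S ≤ ∑ t ∈ T, (prefixError P Mis t x).toReal} ≤
      ENNReal.ofReal (2 * Real.exp (c - S / 4)) := by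
  set F : (Fin m → X) → ℝ≥0∞ := fun x => ∏ t ∈ T, mistakeWeight P Mis t x with hF
  set G : (Fin m → X) → ℝ≥0∞ := fun x => ∏ t ∈ T, (1 + (Mis t).indicator 1 x) with hG
  have hFm : Measurable F := Finset.measurable_fun_prod _ fun t _ => h.measurable_mistakeWeight P t
  have hGm : Measurable G := Finset.measurable_fun_prod _ fun t _ =>
    (measurable_one.indicator (h.measurableSet t)).const_add 1
  have hFi : ∫⁻ x, F x ∂(Measure.pi fun _ => P) ≤ 1 := h.lintegral_prod_mistakeWeight_le P T
  have hGi : ∫⁻ x, G x ∂(Measure.pi fun _ => P) ≤ ENNReal.ofReal (Real.exp (2 * c)) := by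
    refine (h.lintegral_prod_le (q := ENNReal.ofReal q) P T fun t ht => ?_).trans ?_
    · rw [← ENNReal.ofReal_natCast, ← ENNReal.ofReal_natCast, ← ENNReal.ofReal_mul hq0]
      exact ENNReal.ofReal_le_ofReal (by push_cast; exact hq t ht)
    · rw [← ENNReal.ofReal_one, ← ENNReal.ofReal_add zero_le_one hq0,
        ← ENNReal.ofReal_pow (by positivity)]
      refine ENNReal.ofReal_le_ofReal ?_
      calc (1 + q) ^ T.card ≤ (Real.exp q) ^ T.card := by
            gcongr
            rw [add_comm]; exact Real.add_one_le_exp q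
        _ = Real.exp (q * T.card) := by rw [mul_comm, Real.exp_nat_mul]
        _ ≤ _ := Real.exp_le_exp.2 hc
  -- The two thresholds multiply to `exp (S / 2)`, a lower bound for `F * G` on this event; the
  -- shift by `c` equalizes the two Markov bounds.
  have hsub : {x | S ≤ ∑ t ∈ T, (prefixError P Mis t x).toReal} ⊆
      {x | ENNReal.ofReal (Real.exp (S / 4 - c)) ≤ F x} ∪
      {x | ENNReal.ofReal (Real.exp (S / 4 + c)) ≤ G x} := by
    intro x hx
    by_contra hcon
    simp only [mem_union, mem_ofPred_eq, not_or, not_le] at hcon hx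
    have hlt := ENNReal.mul_lt_mul hcon.1 hcon.2
    rw [hF, hG, prod_mistakeWeight_mul_prod, ← ENNReal.ofReal_mul (Real.exp_pos _).le,
      ← Real.exp_add, ENNReal.ofReal_lt_ofReal_iff (Real.exp_pos _), Real.exp_lt_exp] at hlt
    linarith
  have hmarkov : ∀ (H : (Fin m → X) → ℝ≥0∞) (a b : ℝ), Measurable H →
      ∫⁻ x, H x ∂(Measure.pi fun _ => P) ≤ ENNReal.ofReal (Real.exp b) →
      (Measure.pi fun _ => P) {x | ENNReal.ofReal (Real.exp a) ≤ H x} ≤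
        ENNReal.ofReal (Real.exp (b - a)) := by
    intro H a b hH hHi
    refine (meas_ge_le_lintegral_div hH.aemeasurable (by simp [Real.exp_pos])
      ENNReal.ofReal_ne_top).trans ?_
    rw [Real.exp_sub, ENNReal.ofReal_div_of_pos (Real.exp_pos _)]
    gcongr
  refine (measure_mono hsub).trans ((measure_union_le _ _).trans ?_)
  refine (add_le_add (hmarkov F _ 0 hFm (by simpa using hFi)) (hmarkov G _ _ hGm hGi)).trans ?_
  rw [← ENNReal.ofReal_add (Real.exp_pos _).le (Real.exp_pos _).le]
  refine ENNReal.ofReal_le_ofReal (le_of_eq ?_)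
  rw [show 0 - (S / 4 - c) = c - S / 4 by ring, show 2 * c - (S / 4 + c) = c - S / 4 by ring,
    two_mul]

end PrefixMistakes

/-! ### The one-inclusion predictor on prefixes of a sample. -/

section Predictor

variable {X : Type u}

/-- The labelings of the points `x` realized by classifiers in `C`. -/
def patterns (C : Set (X → Bool)) {ι : Type*} (x : ι → X) : Set (ι → Bool) :=
  {v | ∃ h ∈ C, ∀ i, h (x i) = v i}

theorem comp_mem_patterns {C : Set (X → Bool)} {ι κ : Type*} (x : ι → X) (e : κ ≃ ι)
    (v : ι → Bool) : v ∘ e ∈ patterns C (x ∘ e) ↔ v ∈ patterns C x := by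
  refine exists_congr fun h => and_congr_right fun _ => ?_
  exact e.forall_congr_left.trans (by simp)

/-- The pattern set takes finitely many values, so the assumption on `C` makes whatever is computed
from it measurable. -/
theorem measurable_patterns [MeasurableSpace X] {C : Set (X → Bool)}
    (hC : MeasurableRealizability C) {ι : Type*} [Fintype ι] :
    Measurable (patterns C : (ι → X) → Set (ι → Bool)) := by
  rw [measurable_set_iff]
  intro v
  rw [← measurableSet_setOfPred]
  have e := (Fintype.equivFin ι).symm
  have h := hC _ (v ∘ e)
  have hm : Measurable fun x : ι → X => x ∘ e :=
    measurable_pi_lambda _ fun i => measurable_pi_apply _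
  convert hm h using 1
  ext x
  exact (comp_mem_patterns x e v).symm

theorem vcle_patterns {C : Set (X → Bool)} {d : ℕ}
    (hd : ∀ (k : ℕ) (x : Fin k → X), Shatters C x → k ≤ d) {ι : Type*} (x : ι → X) :
    VCLE (patterns C x) d := by
  classical
  intro u hu
  refine hd _ (fun i => x (u.equivFin.symm i)) fun y => ?_
  obtain ⟨v, ⟨h, hh, hv⟩, hvy⟩ := hu fun i => if hi : i ∈ u then y (u.equivFin ⟨i, hi⟩) else false
  refine ⟨h, hh, fun i => ?_⟩
  rw [hv, hvy _ (u.equivFin.symm i).2]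
  simp

variable {m : ℕ}

/-- The label predicted for the point `x t` from the points `x i`, `i < t`, and their labels. -/
noncomputable def prefixGuess (C : Set (X → Bool)) (D : ℕ) (t : Fin m) (x : Fin m → X)
    (y : Fin m → Bool) : Bool :=
  guess D (patterns C fun i : Iic t => x i) (fun i => y i) ⟨t, self_mem_Iic⟩

theorem prefixGuess_congr (C : Set (X → Bool)) (D : ℕ) (t : Fin m) {x x' : Fin m → X}
    {y y' : Fin m → Bool} (hx : ∀ i ≤ t, x i = x' i) (hy : ∀ i < t, y i = y' i) :
    prefixGuess C D t x y = prefixGuess C D t x' y' := by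
  unfold prefixGuess
  -- The label at `t` itself is not used, so it is overwritten on both sides by a common value.
  rw [← guess_update D _ _ _ true, ← guess_update D _ (fun i : Iic t => y' i) _ true]
  congr 1
  · congr 1
    funext i
    exact hx i i.2
  · funext i
    by_cases hi : i = ⟨t, self_mem_Iic⟩
    · simp [hi]
    · rw [Function.update_of_ne hi, Function.update_of_ne hi]
      exact hy i (lt_of_le_of_ne i.2 fun h => hi (Subtype.ext h))

/-- The event that the label of the point number `t` is predicted wrongly. -/
def mistakes (C : Set (X → Bool)) (D : ℕ) (f : X → Bool) (t : Fin m) : Set (Fin m → X) :=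
  {x | prefixGuess C D t x (f ∘ x) ≠ f (x t)}

theorem prefixGuess_comp_swap (C : Set (X → Bool)) (D : ℕ) (f : X → Bool) {j s t : Fin m}
    (hj : j ≤ t) (hs : s ≤ t) (x : Fin m → X) :
    prefixGuess C D t (x ∘ Equiv.swap j s) (f ∘ x ∘ Equiv.swap j s) =
      guess D (patterns C fun i : Iic t => x i) (fun i => f (x i))
        (Equiv.swap (⟨j, hj⟩ : Iic t) ⟨s, hs⟩ ⟨t, self_mem_Iic⟩) := by
  have hsw : ∀ i : Iic t, Equiv.swap j s i = (Equiv.swap (⟨j, hj⟩ : Iic t) ⟨s, hs⟩ i : Iic t) := by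
    rintro ⟨i, hi⟩
    simp only [Equiv.swap_apply_def, Subtype.ext_iff]
    split_ifs <;> rfl
  have h := guess_comp D
    (comp_mem_patterns (C := C) (fun i : Iic t => x i) (Equiv.swap (⟨j, hj⟩ : Iic t) ⟨s, hs⟩))
    (fun i => f (x i)) ⟨t, self_mem_Iic⟩
  rw [← h]
  unfold prefixGuess
  congr 1
  · congr 1
    funext i
    simp [hsw]
  · funext i
    simp [hsw]

section Measurability

variable [MeasurableSpace X] {C : Set (X → Bool)}

theorem measurable_prefixGuess (hC : MeasurableRealizability C) (D : ℕ) (t : Fin m) :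
    Measurable fun p : (Fin m → X) × (Fin m → Bool) => prefixGuess C D t p.1 p.2 := by
  have h1 : Measurable fun p : (Fin m → X) × (Fin m → Bool) =>
      patterns C fun i : Iic t => p.1 i :=
    (measurable_patterns hC).comp
      (measurable_pi_lambda _ fun i => (measurable_pi_apply _).comp measurable_fst)
  have h2 : Measurable fun p : Set (Iic t → Bool) × (Fin m → Bool) =>
      guess D p.1 (fun i => p.2 i) ⟨t, self_mem_Iic⟩ := measurable_of_finite _
  exact h2.comp (h1.prodMk measurable_snd)

theorem mistakeFamily_mistakes (hC : MeasurableRealizability C) {d : ℕ}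
    (hd : ∀ (k : ℕ) (x : Fin k → X), Shatters C x → k ≤ d) {f : X → Bool} (hf : f ∈ C)
    (hfm : Measurable f) : MistakeFamily (m := m) (mistakes C (2 * d) f) (2 * d) where
  measurableSet t := by
    have h1 : Measurable fun x : Fin m → X => prefixGuess C (2 * d) t x (f ∘ x) :=
      (measurable_prefixGuess hC (2 * d) t).comp
        (measurable_id.prodMk (measurable_pi_lambda _ fun i => hfm.comp (measurable_pi_apply i)))
    exact (measurableSet_eq_fun h1 (hfm.comp (measurable_pi_apply t))).compl
  congr t x y hxy := by
    unfold mistakes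
    rw [mem_ofPred_eq, mem_ofPred_eq, hxy t le_rfl,
      prefixGuess_congr C (2 * d) t (y := f ∘ x) (y' := f ∘ y) hxy
        fun i hi => congrArg f (hxy i hi.le)]
  swap_mem s t j x hst hjs := by
    unfold mistakes
    rw [mem_ofPred_eq, mem_ofPred_eq, prefixGuess_comp_swap C _ f (hjs.trans hst.le) hst.le,
      Equiv.swap_apply_of_ne_of_ne, Function.comp_apply, Equiv.swap_apply_of_ne_of_ne]
    · rfl
    · exact (hjs.trans_lt hst).ne'
    · exact hst.ne'
    · exact fun h => (hjs.trans_lt hst).ne' (congrArg Subtype.val h)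
    · exact fun h => hst.ne' (congrArg Subtype.val h)
  sum_le t x := by
    classical
    have hle := card_guess_ne_le (vcle_patterns hd fun i : Iic t => x i)
      (v := fun i => f (x i)) ⟨f, hf, fun _ => rfl⟩
    rw [Finset.sum_subtype (Finset.Iic t) (p := fun j => j ∈ Iic t) (by simp)]
    calc ∑ j : Iic t, (mistakes C (2 * d) f t).indicator (1 : (Fin m → X) → ℝ≥0∞)
          (x ∘ Equiv.swap (j : Fin m) t)
        = ∑ j : Iic t, if guess (2 * d) (patterns C fun i : Iic t => x i) (fun i => f (x i)) j ≠
            f (x j) then 1 else 0 := by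
          refine Finset.sum_congr rfl fun j _ => ?_
          rw [indicator_apply]
          refine if_congr ?_ rfl rfl
          unfold mistakes
          rw [mem_ofPred_eq, prefixGuess_comp_swap C _ f j.2 le_rfl, Equiv.swap_apply_right,
            Function.comp_apply, Equiv.swap_apply_right]
      _ ≤ _ := by
          rw [Finset.sum_boole]
          exact_mod_cast hle

end Measurability

end Predictor

/-! ### The majority vote and the upper bound. -/

section Vote

variable {X : Type u} {m : ℕ}

/-- The second half of the indices below `m`. -/
def lateIndices (m : ℕ) : Finset (Fin m) := Finset.univ.filter fun t => m ≤ 2 * ((t : ℕ) + 1)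

theorem le_two_mul_card_lateIndices (m : ℕ) : m ≤ 2 * (lateIndices m).card := by
  have h1 : (Finset.univ.filter fun t : Fin m => ¬ m ≤ 2 * ((t : ℕ) + 1)).card ≤
      (Finset.range (m / 2)).card := by
    refine Finset.card_le_card_of_injOn (fun t => (t : ℕ)) ?_ (Fin.val_injective.injOn)
    intro t ht
    simp only [Finset.coe_filter, Finset.mem_univ, true_and, mem_ofPred_eq] at ht
    simp only [Finset.coe_range, mem_Iio]
    omega
  have h2 := Finset.card_filter_add_card_filter_not (s := (Finset.univ : Finset (Fin m)))
    (fun t => m ≤ 2 * ((t : ℕ) + 1))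
  rw [Finset.card_range] at h1
  rw [Finset.card_univ, Fintype.card_fin] at h2
  unfold lateIndices
  omega

/-- The label of `z` predicted from the data before index `t`. -/
noncomputable def prefixPredict (C : Set (X → Bool)) (D : ℕ) (S : Fin m → X × Bool) (t : Fin m)
    (z : X) : Bool :=
  prefixGuess C D t (Function.update (fun i => (S i).1) t z) fun i => (S i).2

/-- The majority vote of the predictors based on the prefixes of at least half of the data. -/
noncomputable def vote (C : Set (X → Bool)) (D : ℕ) (S : Fin m → X × Bool) (z : X) : Bool :=
  decide ((lateIndices m).card <
    2 * ((lateIndices m).filter fun t => prefixPredict C D S t z = true).card)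

theorem card_le_of_vote_ne {C : Set (X → Bool)} {D : ℕ} {S : Fin m → X × Bool} {z : X} {b : Bool}
    (h : vote C D S z ≠ b) :
    (lateIndices m).card ≤
      2 * ((lateIndices m).filter fun t => prefixPredict C D S t z ≠ b).card := by
  have h2 := Finset.card_filter_add_card_filter_not (s := lateIndices m)
    (fun t => prefixPredict C D S t z = true)
  cases b with
  | true =>
    simp only [vote, ne_eq, decide_eq_true_eq] at h
    simp only [ne_eq]
    omega
  | false =>
    simp only [vote, ne_eq, decide_eq_false_iff_not, not_not] at h
    simp only [ne_eq, Bool.not_eq_false]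
    omega

theorem prefixPredict_labeled (C : Set (X → Bool)) (D : ℕ) (f : X → Bool) (x : Fin m → X)
    (t : Fin m) (z : X) :
    prefixPredict C D (labeled f x) t z ≠ f z ↔
      Function.update x t z ∈ mistakes C D f t := by
  unfold mistakes prefixPredict
  rw [mem_ofPred_eq, Function.update_self]
  refine not_congr (Eq.congr_left ?_)
  refine prefixGuess_congr C D t (fun i _ => rfl) fun i hi => ?_
  simp [labeled, hi.ne]

variable [MeasurableSpace X] {C : Set (X → Bool)}

theorem measurable_vote_prod (hC : MeasurableRealizability C) (D : ℕ) :
    Measurable fun p : ((Fin m → X) × (Fin m → Bool)) × X =>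
      vote C D (fun i => (p.1.1 i, p.1.2 i)) p.2 := by
  have h1 : ∀ t : Fin m, Measurable fun p : ((Fin m → X) × (Fin m → Bool)) × X =>
      prefixPredict C D (fun i => (p.1.1 i, p.1.2 i)) t p.2 := fun t =>
    (measurable_prefixGuess hC D t).comp
      ((measurable_update'.comp (measurable_fst.fst.prodMk measurable_snd)).prodMk
        measurable_fst.snd)
  have h2 : Measurable fun b : Fin m → Bool =>
      decide ((lateIndices m).card < 2 * ((lateIndices m).filter fun t => b t = true).card) :=
    measurable_of_finite _
  exact h2.comp (measurable_pi_lambda _ h1)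

theorem measurable_vote (hC : MeasurableRealizability C) (D : ℕ) (S : Fin m → X × Bool) :
    Measurable (vote C D S) :=
  (measurable_vote_prod hC D).comp
    (g := fun p : ((Fin m → X) × (Fin m → Bool)) × X =>
      vote C D (fun i => (p.1.1 i, p.1.2 i)) p.2)
    (f := fun z => ((fun i => (S i).1, fun i => (S i).2), z)) (by fun_prop)

theorem measurable_errorRate_vote (hC : MeasurableRealizability C) (D : ℕ) (P : Measure X)
    [IsProbabilityMeasure P] {f : X → Bool} (hf : Measurable f) :
    Measurable fun x : Fin m → X => errorRate P (vote C D (labeled f x)) f := by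
  have h1 : Measurable fun p : (Fin m → X) × X => vote C D (labeled f p.1) p.2 :=
    (measurable_vote_prod hC D).comp
      (g := fun p : ((Fin m → X) × (Fin m → Bool)) × X =>
        vote C D (fun i => (p.1.1 i, p.1.2 i)) p.2)
      (f := fun p : (Fin m → X) × X => ((p.1, fun i => f (p.1 i)), p.2)) (by fun_prop)
  exact measurable_measure_prodMk_left
    (measurableSet_eq_fun h1 (hf.comp measurable_snd)).compl

/-- Where the vote is wrong at least half of the voters are wrong; integrate this pointwise bound.
-/
theorem card_mul_errorRate_vote_le (hC : MeasurableRealizability C) {d : ℕ}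
    (hd : ∀ (k : ℕ) (x : Fin k → X), Shatters C x → k ≤ d) (P : Measure X)
    [IsProbabilityMeasure P] {f : X → Bool} (hf : f ∈ C) (hfm : Measurable f) (x : Fin m → X) :
    ((lateIndices m).card : ℝ≥0∞) * errorRate P (vote C (2 * d) (labeled f x)) f ≤
      2 * ∑ t ∈ lateIndices m, prefixError P (mistakes C (2 * d) f) t x := by
  classical
  set B : Fin m → Set X := fun t => {z | Function.update x t z ∈ mistakes C (2 * d) f t}
  have hBm : ∀ t, MeasurableSet (B t) := fun t =>
    measurable_update x ((mistakeFamily_mistakes hC hd hf hfm).measurableSet t)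
  set W : Set X := {z | vote C (2 * d) (labeled f x) z ≠ f z}
  have hWm : MeasurableSet W := (measurableSet_eq_fun (measurable_vote hC _ _) hfm).compl
  calc ((lateIndices m).card : ℝ≥0∞) * P W
      = ∫⁻ z, ((lateIndices m).card : ℝ≥0∞) * W.indicator 1 z ∂P := by
        rw [lintegral_const_mul _ (measurable_one.indicator hWm), lintegral_indicator_one hWm]
    _ ≤ ∫⁻ z, 2 * ∑ t ∈ lateIndices m, (B t).indicator 1 z ∂P := by
        refine lintegral_mono fun z => ?_
        by_cases hz : z ∈ W
        · rw [indicator_of_mem hz, Pi.one_apply, mul_one]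
          have h1 := card_le_of_vote_ne (C := C) hz
          have h2 : ∑ t ∈ lateIndices m, (B t).indicator (1 : X → ℝ≥0∞) z =
              (((lateIndices m).filter fun t =>
                prefixPredict C (2 * d) (labeled f x) t z ≠ f z).card : ℝ≥0∞) := by
            rw [← Finset.sum_boole]
            refine Finset.sum_congr rfl fun t _ => ?_
            rw [indicator_apply]
            exact if_congr (prefixPredict_labeled C _ f x t z).symm rfl rfl
          rw [h2]
          exact (Nat.cast_le.2 h1).trans (by simp)
        · rw [indicator_of_notMem hz, mul_zero]
          exact zero_le
    _ = _ := by
        rw [lintegral_const_mul _ (Finset.measurable_fun_sum _ fun t _ =>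
          measurable_one.indicator (hBm t)),
          lintegral_finsetSum _ fun t _ => measurable_one.indicator (hBm t)]
        congr 1
        exact Finset.sum_congr rfl fun t _ => lintegral_indicator_one (hBm t)

theorem measure_errorRate_vote_gt_le (hC : MeasurableRealizability C) {d : ℕ}
    (hd : ∀ (k : ℕ) (x : Fin k → X), Shatters C x → k ≤ d) (P : Measure X)
    [IsProbabilityMeasure P] {f : X → Bool} (hf : f ∈ C) (hfm : Measurable f) {ε : ℝ}
    (hε : 0 ≤ ε) (hm : 0 < m) :
    (Measure.pi fun _ : Fin m => P)
        {x | ENNReal.ofReal ε < errorRate P (vote C (2 * d) (labeled f x)) f} ≤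
      ENNReal.ofReal (2 * Real.exp (2 * d - ε * m / 16)) := by
  have hmR : (0 : ℝ) < m := by exact_mod_cast hm
  have hcard : (lateIndices m).card ≤ m := by
    simpa using Finset.card_le_univ (lateIndices m)
  have hcardR : ((lateIndices m).card : ℝ) ≤ m := by exact_mod_cast hcard
  have hhalf : (m : ℝ) ≤ 2 * (lateIndices m).card := by
    exact_mod_cast le_two_mul_card_lateIndices m
  -- Late indices satisfy `t + 1 ≥ m / 2`, so `q = 4 * d / m` dominates `2 * d / (t + 1)`, and at
  -- most `m` of them give `c = 2 * d`. There are at least `m / 2` voters, so a vote with error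
  -- above `ε` forces the sum to be at least `ε * m / 4`.
  have h := (mistakeFamily_mistakes (m := m) hC hd hf hfm).measure_sum_prefixError_ge_le P
    (q := 4 * d / m) (c := 2 * d) (S := ε * m / 4) (by positivity) (lateIndices m)
    (by
      intro t ht
      have ht' : m ≤ 2 * ((t : ℕ) + 1) := by simpa [lateIndices] using ht
      have ht'' : (m : ℝ) ≤ 2 * ((t : ℕ) + 1) := by exact_mod_cast ht'
      rw [div_mul_eq_mul_div, le_div_iff₀ hmR]
      push_cast
      nlinarith [(Nat.cast_nonneg d : (0 : ℝ) ≤ d)])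
    (by
      rw [div_mul_eq_mul_div, div_le_iff₀ hmR]
      nlinarith [(Nat.cast_nonneg d : (0 : ℝ) ≤ d)])
  refine (measure_mono fun x hx => ?_).trans (h.trans (le_of_eq ?_))
  · rw [mem_ofPred_eq] at hx ⊢
    have hle := card_mul_errorRate_vote_le hC hd P hf hfm x
    have hne : ∀ t, prefixError P (mistakes C (2 * d) f) t x ≠ ⊤ := fun t => measure_ne_top _ _
    rw [← ENNReal.toReal_sum fun t _ => hne t]
    have hfin : 2 * ∑ t ∈ lateIndices m, prefixError P (mistakes C (2 * d) f) t x ≠ ⊤ :=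
      ENNReal.mul_ne_top (by simp) (ENNReal.sum_ne_top.2 fun t _ => hne t)
    have hr := ENNReal.toReal_mono hfin hle
    rw [ENNReal.toReal_mul, ENNReal.toReal_mul, ENNReal.toReal_natCast, ENNReal.toReal_ofNat] at hr
    have hεx : ε ≤ (errorRate P (vote C (2 * d) (labeled f x)) f).toReal :=
      (ENNReal.ofReal_le_iff_le_toReal (measure_ne_top _ _)).1 hx.le
    nlinarith
  · congr 3
    ring

/-- The deterministic learning algorithm which outputs the majority vote. -/
noncomputable def voteAlgorithm (hC : MeasurableRealizability C) (D : ℕ) :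
    LearningAlgorithm.{u, v} X where
  Ω := PUnit
  measurableSpace := ⊤
  μ := @Measure.dirac PUnit ⊤ PUnit.unit
  isProbabilityMeasure := @Measure.dirac.isProbabilityMeasure PUnit ⊤ PUnit.unit
  run _ _ S := vote C D S
  measurable_run _ _ S := measurable_vote hC D S

theorem isPACLearner_voteAlgorithm (hC : MeasurableRealizability C) {d : ℕ}
    (hd : ∀ (k : ℕ) (x : Fin k → X), Shatters C x → k ≤ d) (hCm : ∀ h ∈ C, Measurable h)
    {ε δ : ℝ} (hε : 0 ≤ ε) (hδ : 0 < δ) (hm : 0 < m)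
    (hbound : 2 * Real.exp (2 * d - ε * m / 16) ≤ δ) :
    IsPACLearner C m ε δ (voteAlgorithm.{u, v} hC (2 * d)) := by
  intro P _ f hf
  have hfm := hCm f hf
  set E : Set (Fin m → X) :=
    {x | errorRate P (vote C (2 * d) (labeled f x)) f ≤ ENNReal.ofReal ε} with hE
  have hEm : MeasurableSet E :=
    measurableSet_le (measurable_errorRate_vote hC (2 * d) P hfm) measurable_const
  have hev : successEvent (voteAlgorithm.{u, v} hC (2 * d)) m ε P f = Prod.snd ⁻¹' E := rfl
  rw [hev]
  refine ⟨(measurable_snd hEm).nullMeasurableSet, ?_⟩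
  rw [(measurePreserving_snd (μ := (voteAlgorithm.{u, v} hC (2 * d)).μ)
    (ν := Measure.pi fun _ : Fin m => P)).measure_preimage hEm.nullMeasurableSet]
  have hc : (Measure.pi fun _ : Fin m => P) Eᶜ ≤ ENNReal.ofReal δ := by
    have : Eᶜ = {x | ENNReal.ofReal ε < errorRate P (vote C (2 * d) (labeled f x)) f} := by
      ext x; simp [hE]
    rw [this]
    exact (measure_errorRate_vote_gt_le hC hd P hf hfm hε hm).trans
      (ENNReal.ofReal_le_ofReal hbound)
  rw [ENNReal.ofReal_sub _ hδ.le, ENNReal.ofReal_one, tsub_le_iff_right,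
    ← prob_add_prob_compl (μ := Measure.pi fun _ : Fin m => P) hEm]
  gcongr

end Vote

/-! ### Lower bounds by pairing indistinguishable targets. -/

section LowerBound

theorem exists_agree_differ {X : Type u} {C : Set (X → Bool)} (hC : 3 ≤ C.encard) :
    ∃ h ∈ C, ∃ h' ∈ C, ∃ x₀ x₁ : X, h x₀ = h' x₀ ∧ h x₁ ≠ h' x₁ := by
  obtain ⟨s, hs, hs3⟩ := exists_subset_encard_eq hC
  obtain ⟨a, b, c, hab, hac, hbc, rfl⟩ := encard_eq_three.1 hs3
  have ha : a ∈ C := hs (by simp)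
  have hb : b ∈ C := hs (by simp)
  have hc : c ∈ C := hs (by simp)
  obtain ⟨p, hp⟩ := Function.ne_iff.1 hab
  by_cases hcp : a p = c p
  · obtain ⟨q, hq⟩ := Function.ne_iff.1 hac
    exact ⟨a, ha, c, hc, p, q, hcp, hq⟩
  -- With only two labels, `b` and `c` both differ from `a` at `p` and hence agree there.
  · obtain ⟨q, hq⟩ := Function.ne_iff.1 hbc
    refine ⟨b, hb, c, hc, p, q, ?_, hq⟩
    cases h1 : a p <;> cases h2 : b p <;> cases h3 : c p <;> simp_all

variable {X : Type u} [MeasurableSpace X] {C : Set (X → Bool)} {m : ℕ} {ε δ : ℝ}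
  {A : LearningAlgorithm.{u, v} X}
  {κ : Type*} [MeasurableSpace κ] {ν : Measure κ} {g : κ → X}

/-- The event that the algorithm fails on the data `g ∘ z` labeled by `f`. -/
def failureEvent (A : LearningAlgorithm.{u, v} X) (m : ℕ) (ε : ℝ) (ν : Measure κ) (g : κ → X)
    (f : X → Bool) : Set (A.Ω × (Fin m → κ)) :=
  {p | ENNReal.ofReal ε < errorRate (ν.map g) (A.run p.1 m (labeled f (g ∘ p.2))) f}

/-- Sampling from a pushforward lets the hard distributions live on a finite discrete `κ`;
singletons of `X` need not be measurable. -/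
theorem IsPACLearner.measure_failureEvent_le [IsProbabilityMeasure ν]
    (hA : IsPACLearner C m ε δ A) (hg : Measurable g) {f : X → Bool} (hf : f ∈ C) :
    NullMeasurableSet (failureEvent A m ε ν g f) (A.μ.prod (Measure.pi fun _ => ν)) ∧
      (A.μ.prod (Measure.pi fun _ => ν)) (failureEvent A m ε ν g f) ≤ ENNReal.ofReal δ := by
  have : IsProbabilityMeasure (ν.map g) := Measure.isProbabilityMeasure_map hg.aemeasurable
  have hmp : MeasurePreserving (fun p : A.Ω × (Fin m → κ) => (p.1, g ∘ p.2))
      (A.μ.prod (Measure.pi fun _ => ν)) (A.μ.prod (Measure.pi fun _ => ν.map g)) :=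
    (MeasurePreserving.id A.μ).prod
      (measurePreserving_pi (fun _ : Fin m => ν) (fun _ => ν.map g) fun _ => ⟨hg, rfl⟩)
  obtain ⟨hnull, hle⟩ := hA (ν.map g) f hf
  have hev : failureEvent A m ε ν g f =
      ((fun p : A.Ω × (Fin m → κ) => (p.1, g ∘ p.2)) ⁻¹' successEvent A m ε (ν.map g) f)ᶜ := by
    ext p
    simp [failureEvent, successEvent]
  have hnull' := hnull.preimage hmp.quasiMeasurePreserving
  rw [hev]
  refine ⟨hnull'.compl, ?_⟩
  rw [prob_compl_eq_one_sub₀ hnull', hmp.measure_preimage hnull, tsub_le_iff_right]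
  calc (1 : ℝ≥0∞) = ENNReal.ofReal (δ + (1 - δ)) := by simp
    _ ≤ ENNReal.ofReal δ + ENNReal.ofReal (1 - δ) := ENNReal.ofReal_add_le
    _ ≤ _ := by gcongr

theorem mem_failureEvent_or_of_agree (hg : Measurable g) {f f' : X → Bool} (hf : Measurable f)
    (hf' : Measurable f') {p : A.Ω × (Fin m → κ)} (hε : 0 ≤ ε)
    (hagree : ∀ i, f (g (p.2 i)) = f' (g (p.2 i)))
    (hdiff : ENNReal.ofReal (2 * ε) < ν {k | f (g k) ≠ f' (g k)}) :
    p ∈ failureEvent A m ε ν g f ∨ p ∈ failureEvent A m ε ν g f' := by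
  by_contra! hcon
  simp only [failureEvent, mem_ofPred_eq, not_lt] at hcon
  have hlab : labeled f (g ∘ p.2) = labeled f' (g ∘ p.2) := by
    funext i
    simp [labeled, hagree i]
  rw [← hlab] at hcon
  set h := A.run p.1 m (labeled f (g ∘ p.2))
  have hh : Measurable h := A.measurable_run _ _ _
  refine absurd hdiff (not_lt.2 ?_)
  unfold errorRate at hcon
  have hs : MeasurableSet {x | h x ≠ f x} := (measurableSet_eq_fun hh hf).compl
  have hs' : MeasurableSet {x | h x ≠ f' x} := (measurableSet_eq_fun hh hf').compl
  rw [Measure.map_apply hg hs, Measure.map_apply hg hs'] at hcon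
  rw [two_mul, ENNReal.ofReal_add hε hε]
  refine le_trans (measure_mono ?_) ((measure_union_le _ _).trans (add_le_add hcon.1 hcon.2))
  intro k hk
  simp only [mem_union, mem_preimage, mem_ofPred_eq] at hk ⊢
  by_contra! h'
  exact hk (h'.1.symm.trans h'.2)

/-- If on every sample in `Z` the targets can be paired such that paired targets have the same
labels on the sample but are far from each other, then the samples in `Z` have small
probability. -/
theorem IsPACLearner.measure_le_of_pairing [IsProbabilityMeasure ν] (hA : IsPACLearner C m ε δ A)
    (hC : ∀ h ∈ C, Measurable h) (hε : 0 ≤ ε) (hg : Measurable g) {ι : Type*}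
    [Fintype ι] [Nonempty ι] {f : ι → X → Bool} (hf : ∀ y, f y ∈ C) {Z : Set (Fin m → κ)}
    (hZ : MeasurableSet Z) (τ : (Fin m → κ) → ι ≃ ι)
    (hagree : ∀ z ∈ Z, ∀ y i, f y (g (z i)) = f (τ z y) (g (z i)))
    (hdiff : ∀ z ∈ Z, ∀ y, ENNReal.ofReal (2 * ε) < ν {k | f y (g k) ≠ f (τ z y) (g k)}) :
    (Measure.pi fun _ : Fin m => ν) Z ≤ ENNReal.ofReal (2 * δ) := by
  set Q := A.μ.prod (Measure.pi fun _ : Fin m => ν) with hQ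
  set S : ι → Set (A.Ω × (Fin m → κ)) := fun y => failureEvent A m ε ν g (f y) with hS
  have hSp := fun y => hA.measure_failureEvent_le (ν := ν) hg (hf y)
  -- The algorithm fails for `y` or for `τ p.2 y`. Summing over `y` and reindexing by the bijection
  -- counts each failure twice.
  have hpt : ∀ p : A.Ω × (Fin m → κ), (Fintype.card ι : ℝ≥0∞) *
      (Prod.snd ⁻¹' Z : Set (A.Ω × (Fin m → κ))).indicator 1 p ≤
      2 * ∑ y, (S y).indicator 1 p := by
    intro p
    by_cases hp : p.2 ∈ Z
    · rw [indicator_of_mem (show p ∈ Prod.snd ⁻¹' Z from hp), Pi.one_apply, mul_one, two_mul]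
      calc (Fintype.card ι : ℝ≥0∞) = ∑ y : ι, 1 := by simp
        _ ≤ ∑ y, ((S y).indicator 1 p + (S (τ p.2 y)).indicator 1 p) := by
          refine Finset.sum_le_sum fun y _ => ?_
          rcases mem_failureEvent_or_of_agree (A := A) hg (hC _ (hf y)) (hC _ (hf (τ p.2 y))) hε
            (hagree p.2 hp y) (hdiff p.2 hp y) with h | h
          · rw [indicator_of_mem (show p ∈ S y from h)]; exact le_self_add
          · rw [indicator_of_mem (show p ∈ S (τ p.2 y) from h)]; exact le_add_self
        _ = _ := by
          rw [Finset.sum_add_distrib, (τ p.2).sum_comp fun y => (S y).indicator (1 : _ × _ → ℝ≥0∞) p]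
    · rw [indicator_of_notMem (show p ∉ Prod.snd ⁻¹' Z from hp), mul_zero]
      exact zero_le
  have hZm : MeasurableSet (Prod.snd ⁻¹' Z : Set (A.Ω × (Fin m → κ))) := measurable_snd hZ
  have hZQ : Q (Prod.snd ⁻¹' Z) = (Measure.pi fun _ : Fin m => ν) Z :=
    measurePreserving_snd.measure_preimage hZ.nullMeasurableSet
  have hae : ∀ y, AEMeasurable ((S y).indicator (1 : A.Ω × (Fin m → κ) → ℝ≥0∞)) Q := fun y =>
    aemeasurable_const.indicator₀ (hSp y).1
  have hint : (Fintype.card ι : ℝ≥0∞) * (Measure.pi fun _ : Fin m => ν) Z ≤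
      Fintype.card ι * ENNReal.ofReal (2 * δ) := by
    calc (Fintype.card ι : ℝ≥0∞) * (Measure.pi fun _ : Fin m => ν) Z
        = ∫⁻ p, (Fintype.card ι : ℝ≥0∞) *
            (Prod.snd ⁻¹' Z : Set (A.Ω × (Fin m → κ))).indicator 1 p ∂Q := by
          rw [lintegral_const_mul _ (measurable_one.indicator hZm), lintegral_indicator_one hZm,
            hZQ]
      _ ≤ ∫⁻ p, 2 * ∑ y, (S y).indicator 1 p ∂Q := lintegral_mono hpt
      _ = 2 * ∑ y, Q (S y) := by
          rw [lintegral_const_mul'' _ (Finset.aemeasurable_fun_sum _ fun y _ => hae y),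
            lintegral_finsetSum' _ fun y _ => hae y]
          congr 1
          exact Finset.sum_congr rfl fun y _ => lintegral_indicator_one₀ (hSp y).1
      _ ≤ 2 * ∑ _y : ι, ENNReal.ofReal δ := by
          gcongr with y
          exact (hSp y).2
      _ = _ := by
          rw [Finset.sum_const, Finset.card_univ, nsmul_eq_mul, ENNReal.ofReal_mul (by norm_num),
            ENNReal.ofReal_ofNat]
          ring
  rwa [ENNReal.mul_le_mul_iff_right (by simp) (ENNReal.natCast_ne_top _)] at hint

/-- The measure on a finite type with weights `w`. -/
noncomputable def weighted {κ : Type*} [MeasurableSpace κ] [Fintype κ] (w : κ → ℝ) : Measure κ :=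
  ∑ k, ENNReal.ofReal (w k) • Measure.dirac k

open Classical in
theorem weighted_apply {κ : Type*} [MeasurableSpace κ] [DiscreteMeasurableSpace κ] [Fintype κ]
    {w : κ → ℝ} (hw : ∀ k, 0 ≤ w k) (s : Set κ) :
    weighted w s = ENNReal.ofReal (∑ k, if k ∈ s then w k else 0) := by
  rw [ENNReal.ofReal_sum_of_nonneg fun k _ => by split_ifs <;> simp [hw]]
  simp only [weighted, Measure.coe_finsetSum, Finset.sum_apply, Measure.smul_apply, smul_eq_mul,
    Measure.dirac_apply]
  refine Finset.sum_congr rfl fun k _ => ?_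
  by_cases hk : k ∈ s <;> simp [hk]

theorem isProbabilityMeasure_weighted {κ : Type*} [MeasurableSpace κ] [DiscreteMeasurableSpace κ]
    [Fintype κ] {w : κ → ℝ} (hw : ∀ k, 0 ≤ w k) (h1 : ∑ k, w k = 1) :
    IsProbabilityMeasure (weighted w) :=
  ⟨by rw [weighted_apply hw]; simp [h1]⟩

theorem exp_neg_two_mul_le {x : ℝ} (h0 : 0 ≤ x) (h1 : x ≤ 1 / 2) : Real.exp (-(2 * x)) ≤ 1 - x := by
  rw [Real.exp_neg, inv_le_comm₀ (Real.exp_pos _) (by linarith)]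
  refine le_trans ?_ (Real.add_one_le_exp (2 * x))
  rw [inv_le_iff_one_le_mul₀ (by linarith)]
  nlinarith

/-- The number of samples needed to see a rare point with high probability. -/
theorem IsPACLearner.exp_neg_le (hA : IsPACLearner C m ε δ A) (hC : ∀ h ∈ C, Measurable h)
    (hcard : 3 ≤ C.encard) (hε : 0 < ε) (hε' : ε ≤ 1 / 8) (hδ : 0 ≤ δ) :
    Real.exp (-(6 * ε * m)) ≤ 2 * δ := by
  obtain ⟨h, hh, h', hh', x₀, x₁, h0, h1⟩ := exists_agree_differ hcard
  set w : Bool → ℝ := fun b => if b then 3 * ε else 1 - 3 * ε with hw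
  have hw0 : ∀ b, 0 ≤ w b := fun b => by
    cases b <;> simp only [hw] <;> norm_num <;> linarith
  have hw1 : ∑ b, w b = 1 := by simp [hw]
  have := isProbabilityMeasure_weighted hw0 hw1
  have key := hA.measure_le_of_pairing (ν := weighted w) (g := fun b => if b then x₁ else x₀) hC
    hε.le (measurable_of_finite _) (ι := Bool) (f := fun b => if b then h else h')
    (fun b => by cases b <;> simp [hh, hh']) (Z := {fun _ => false}) (measurableSet_singleton _)
    (fun _ => Equiv.boolNot)
    (by
      rintro z rfl y i
      cases y <;> simp [h0])
    (by
      rintro z rfl y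
      rw [weighted_apply hw0]
      refine (ENNReal.ofReal_lt_ofReal_iff_of_nonneg (by linarith)).2 ?_
      cases y <;> simp [hw, h0, h1, h1.symm] <;> linarith)
  rw [Measure.pi_singleton] at key
  simp only [Finset.prod_const, Finset.card_univ, Fintype.card_fin, weighted_apply hw0] at key
  rw [← ENNReal.ofReal_pow (Finset.sum_nonneg fun _ _ => by split_ifs <;> simp [hw0]),
    ENNReal.ofReal_le_ofReal_iff (by linarith)] at key
  simp only [mem_singleton_iff, Fintype.sum_bool, hw] at key
  norm_num at key
  refine le_trans ?_ key
  have := exp_neg_two_mul_le (x := 3 * ε) (by linarith) (by linarith)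
  calc Real.exp (-(6 * ε * m)) = Real.exp (-(2 * (3 * ε))) ^ m := by
        rw [← Real.exp_nat_mul]; ring_nf
    _ ≤ _ := by gcongr

/-- The number of samples needed to see many of `n` rare points. -/
theorem IsPACLearner.card_le_of_shatters {n : ℕ} (hA : IsPACLearner C m ε δ A)
    (hC : ∀ h ∈ C, Measurable h) {x : Fin (n + 1) → X} (hx : Shatters C x) (hε : 0 < ε)
    (hε' : ε ≤ 1 / 8) (hδ : 0 ≤ δ) (hδ' : δ ≤ 1 / 4) : (n : ℝ) ≤ 32 * ε * m := by
  classical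
  rcases Nat.eq_zero_or_pos n with rfl | hn
  · simp; positivity
  by_contra! hlt
  have hnR : (0 : ℝ) < n := by exact_mod_cast hn
  choose f hf hfx using hx
  -- Point `0` is heavy and the other `n` share mass `8 * ε`. The pairing `τ` flips the labels of
  -- all unseen light points `U`; when more than a quarter are unseen, the flipped mass exceeds `2 *
  -- ε`.
  set w : Fin (n + 1) → ℝ := Fin.cons (1 - 8 * ε) fun _ => 8 * ε / n with hw
  have hw0 : ∀ k, 0 ≤ w k := by
    refine Fin.cases ?_ fun j => ?_
    · simp only [hw, Fin.cons_zero]; linarith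
    · simp only [hw, Fin.cons_succ]; positivity
  have hws : ∀ k, k ≠ 0 → w k = 8 * ε / n := by
    refine Fin.cases (by simp) fun j _ => ?_
    simp [hw]
  have hw1 : ∑ k, w k = 1 := by
    rw [Fin.sum_univ_succ]
    simp only [hw, Fin.cons_zero, Fin.cons_succ, Finset.sum_const, Finset.card_univ,
      Fintype.card_fin, nsmul_eq_mul]
    field_simp
    ring
  have := isProbabilityMeasure_weighted hw0 hw1
  set ν := weighted w with hν
  set U : (Fin m → Fin (n + 1)) → Finset (Fin (n + 1)) := fun z =>
    Finset.univ.filter fun k => k ≠ 0 ∧ ∀ i, z i ≠ k with hU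
  have hUν : ∀ z, ν (U z) = ENNReal.ofReal ((U z).card * (8 * ε / n)) := by
    intro z
    rw [hν, weighted_apply hw0]
    congr 1
    simp only [Finset.mem_coe]
    rw [← Finset.sum_filter, Finset.filter_mem_eq_inter, Finset.univ_inter, ← nsmul_eq_mul]
    refine Finset.sum_eq_card_nsmul fun k hk => hws k ?_
    simp only [hU, Finset.mem_filter] at hk
    exact hk.2.1
  set τ : (Fin m → Fin (n + 1)) → Equiv.Perm (Fin (n + 1) → Bool) := fun z =>
    Function.Involutive.toPerm (fun y k => if k ∈ U z then !y k else y k) (by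
      intro y
      funext k
      by_cases hk : k ∈ U z <;> simp [hk]) with hτ
  have hτ_apply : ∀ z y k, τ z y k = if k ∈ U z then !y k else y k := fun _ _ _ => rfl
  set Z : Set (Fin m → Fin (n + 1)) := {z | n < 4 * (U z).card} with hZ
  have key := hA.measure_le_of_pairing (ν := ν) (g := x) hC hε.le (measurable_of_finite _)
    (f := f) hf (Z := Z) (Set.toFinite _).measurableSet τ
    (by
      intro z _ y i
      rw [hfx, hfx, hτ_apply, if_neg]
      simp [hU])
    (by
      intro z hz y
      have : {k | f y (x k) ≠ f (τ z y) (x k)} = U z := by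
        ext k
        rw [mem_ofPred_eq, hfx, hfx, hτ_apply]
        by_cases hk : k ∈ U z <;> simp [hk]
      rw [this, hUν, ENNReal.ofReal_lt_ofReal_iff_of_nonneg (by linarith), mul_div_assoc',
        lt_div_iff₀ hnR]
      have hz' : (n : ℝ) < 4 * (U z).card := by exact_mod_cast hz
      nlinarith)
  set N : (Fin m → Fin (n + 1)) → ℝ≥0∞ := fun z => ∑ i, ({0}ᶜ : Set (Fin (n + 1))).indicator 1 (z i)
    with hN
  have hNm : Measurable N := measurable_of_finite _
  have hp : ν {0}ᶜ = ENNReal.ofReal (8 * ε) := by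
    rw [hν, weighted_apply hw0, Fin.sum_univ_succ]
    congr 1
    simp [hw]
    field_simp
  have hNint : ∫⁻ z, N z ∂(Measure.pi fun _ : Fin m => ν) = m * ENNReal.ofReal (8 * ε) := by
    rw [lintegral_finsetSum _ fun i _ => measurable_of_finite _]
    have : ∀ i : Fin m, ∫⁻ z, ({0}ᶜ : Set (Fin (n + 1))).indicator (1 : Fin (n + 1) → ℝ≥0∞) (z i)
        ∂(Measure.pi fun _ : Fin m => ν) = ENNReal.ofReal (8 * ε) := by
      intro i
      rw [(measurePreserving_eval (fun _ : Fin m => ν) i).lintegral_comp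
        (f := ({0}ᶜ : Set (Fin (n + 1))).indicator (1 : Fin (n + 1) → ℝ≥0∞)) (measurable_of_finite _),
        lintegral_indicator_one (Set.toFinite _).measurableSet, hp]
    simp only [this, Finset.sum_const, Finset.card_univ, Fintype.card_fin, nsmul_eq_mul]
  have hNcard : ∀ z, N z = ((Finset.univ.filter fun i => z i ≠ 0).card : ℝ≥0∞) := by
    intro z
    rw [← Finset.sum_boole]
    refine Finset.sum_congr rfl fun i _ => ?_
    simp [indicator_apply]
  -- Outside `Z` at least `3 * n / 4` light points are seen, each by a different draw. The expected
  -- number of light draws is `8 * ε * m < n / 4`, so Markov gives probability at most `1 / 3`.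
  have hsub : Zᶜ ⊆ {z | ENNReal.ofReal (3 * n / 4) ≤ N z} := by
    intro z hz
    simp only [hZ, mem_compl_iff, mem_ofPred_eq, not_lt] at hz
    rw [mem_ofPred_eq, hNcard, ← ENNReal.ofReal_natCast]
    refine ENNReal.ofReal_le_ofReal ?_
    have hcov : (Finset.univ.erase (0 : Fin (n + 1))) ⊆
        U z ∪ (Finset.univ.filter fun i => z i ≠ 0).image z := by
      intro k hk
      have hk0 : k ≠ 0 := (Finset.mem_erase.1 hk).1
      by_cases hki : ∀ i, z i ≠ k
      · exact Finset.mem_union_left _ (by simp [hU, hk0, hki])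
      · push Not at hki
        obtain ⟨i, rfl⟩ := hki
        exact Finset.mem_union_right _ (Finset.mem_image_of_mem _ (by simp [hk0]))
    have hc := (Finset.card_le_card hcov).trans (Finset.card_union_le _ _)
    rw [Finset.card_erase_of_mem (Finset.mem_univ _), Finset.card_univ, Fintype.card_fin] at hc
    have hi := Finset.card_image_le (s := Finset.univ.filter fun i => z i ≠ 0) (f := z)
    have h4 : 3 * n ≤ 4 * (Finset.univ.filter fun i => z i ≠ 0).card := by omega
    have h4' : (3 * n : ℝ) ≤ 4 * (Finset.univ.filter fun i => z i ≠ 0).card := by exact_mod_cast h4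
    linarith
  have hmarkov : (Measure.pi fun _ : Fin m => ν) Zᶜ ≤ ENNReal.ofReal (1 / 3) := by
    refine (measure_mono hsub).trans ((meas_ge_le_lintegral_div hNm.aemeasurable
      (by simpa using hn) ENNReal.ofReal_ne_top).trans ?_)
    rw [hNint, ← ENNReal.ofReal_natCast, ← ENNReal.ofReal_mul (by positivity),
      ← ENNReal.ofReal_div_of_pos (by positivity)]
    refine ENNReal.ofReal_le_ofReal ?_
    rw [div_le_iff₀ (by positivity)]
    linarith
  have hone : (1 : ℝ≥0∞) ≤ ENNReal.ofReal (2 * δ + 1 / 3) := by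
    rw [← prob_add_prob_compl (μ := Measure.pi fun _ : Fin m => ν)
      (Set.toFinite Z).measurableSet, ENNReal.ofReal_add (by linarith) (by norm_num)]
    exact add_le_add key hmarkov
  rw [ENNReal.one_le_ofReal] at hone
  linarith

end LowerBound

/-! ### Passage from learners to the sample complexity. -/

section SampleComplexity

variable {X : Type u} {C : Set (X → Bool)}

theorem le_vcDim_of_shatters {d : ℕ} (hd : vcDim C = d) (k : ℕ) (x : Fin k → X)
    (hx : Shatters C x) : k ≤ d := by
  have : (k : ℕ∞) ≤ vcDim C := le_iSup₂ (f := fun (k : ℕ) (_ : ∃ x : Fin k → X, Shatters C x) =>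
    (k : ℕ∞)) k ⟨x, hx⟩
  rw [hd] at this
  exact_mod_cast this

theorem exists_shatters_of_vcDim_eq {n : ℕ} (hd : vcDim C = (n + 1 : ℕ)) :
    ∃ x : Fin (n + 1) → X, Shatters C x := by
  have hlt : (n : ℕ∞) < vcDim C := by
    rw [hd]; exact_mod_cast Nat.lt_succ_self n
  unfold vcDim at hlt
  simp only [lt_iSup_iff] at hlt
  obtain ⟨k, ⟨x, hx⟩, hk⟩ := hlt
  have h1 : n < k := by exact_mod_cast hk
  have h2 := le_vcDim_of_shatters hd k x hx
  obtain rfl : k = n + 1 := by omega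
  exact ⟨x, hx⟩

theorem Log_one_div {δ : ℝ} (hδ : 0 < δ) (hδ' : δ ≤ 1 / 3) :
    Log (1 / δ) = Real.log (1 / δ) ∧ 1 ≤ Real.log (1 / δ) := by
  have h : Real.exp 1 ≤ 1 / δ := by
    rw [le_div_iff₀ hδ]
    nlinarith [Real.exp_one_lt_d9, Real.exp_pos 1]
  refine ⟨by rw [Log, max_eq_left h], ?_⟩
  rwa [Real.le_log_iff_exp_le (by positivity)]

variable [MeasurableSpace X]

theorem sampleComplexity_le (hC : ∀ h ∈ C, Measurable h) (hr : MeasurableRealizability C) {d : ℕ}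
    (hd : vcDim C = d) {ε δ : ℝ} (hε : 0 < ε) (hε' : ε ≤ 1) (hδ : 0 < δ) (hδ' : δ ≤ 1 / 3) :
    (sampleComplexity.{u, v} C ε δ : ℝ≥0∞) ≤
      ENNReal.ofReal (33 * (1 / ε * (d + Log (1 / δ)))) := by
  obtain ⟨hL, hL1⟩ := Log_one_div hδ hδ'
  rw [hL]
  set L := Real.log (1 / δ) with hLdef
  have hd0 : (0 : ℝ) ≤ d := Nat.cast_nonneg d
  -- This makes the exponent at most `-2 * L`; one `exp (-L)` is `δ` and the other absorbs the
  -- factor `2`. Rounding up costs at most `1 ≤ (d + L) / ε`, whence `33`.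
  set r : ℝ := 32 * (d + L) / ε with hr_def
  have hr0 : 0 < r := by positivity
  have hm0 : 0 < ⌈r⌉₊ := Nat.ceil_pos.2 hr0
  have hbound : 2 * Real.exp (2 * d - ε * (⌈r⌉₊ : ℝ) / 16) ≤ δ := by
    have h1 : 32 * (d + L) ≤ ε * (⌈r⌉₊ : ℝ) := by
      have := Nat.le_ceil r
      rw [hr_def, div_le_iff₀ hε] at this
      linarith
    have h2 : Real.exp (-L) = δ := by
      rw [hLdef, one_div, Real.log_inv, neg_neg, Real.exp_log hδ]
    have h3 : (2 : ℝ) ≤ Real.exp L :=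
      le_trans (by linarith) (Real.add_one_le_exp L)
    calc 2 * Real.exp (2 * d - ε * (⌈r⌉₊ : ℝ) / 16) ≤ Real.exp L * Real.exp (-L + -L) := by
          gcongr
          linarith
      _ = δ := by rw [← Real.exp_add, ← h2]; congr 1; ring
  have hlearn := isPACLearner_voteAlgorithm.{u, v} hr (le_vcDim_of_shatters hd) hC hε.le hδ hm0
    hbound
  have hle : sampleComplexity.{u, v} C ε δ ≤ (⌈r⌉₊ : ℕ) := iInf₂_le _ ⟨_, hlearn⟩
  calc (sampleComplexity.{u, v} C ε δ : ℝ≥0∞) ≤ ((⌈r⌉₊ : ℕ∞) : ℝ≥0∞) := by exact_mod_cast hle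
    _ = ENNReal.ofReal (⌈r⌉₊ : ℝ) := by simp
    _ ≤ _ := by
        refine ENNReal.ofReal_le_ofReal ?_
        have h1 := (Nat.ceil_lt_add_one hr0.le).le
        have h2 : 1 ≤ (d + L) / ε := by
          rw [le_div_iff₀ hε]; linarith
        have h3 : r = 32 * ((d + L) / ε) := by rw [hr_def]; ring
        have h4 : 33 * (1 / ε * (d + L)) = 33 * ((d + L) / ε) := by ring
        linarith

theorem IsPACLearner.le_mul {A : LearningAlgorithm.{u, v} X} {m d : ℕ} {ε δ : ℝ}
    (hA : IsPACLearner C m ε δ A) (hC : ∀ h ∈ C, Measurable h) (hcard : 3 ≤ C.encard)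
    (hd : vcDim C = d) (hε : 0 < ε) (hε' : ε ≤ 1 / 8) (hδ : 0 < δ) (hδ' : δ ≤ 1 / 4) :
    1 / ε * (d + Log (1 / δ)) ≤ 76 * m := by
  obtain ⟨hL, hL1⟩ := Log_one_div hδ (by linarith)
  rw [hL]
  set L := Real.log (1 / δ) with hLdef
  have h2 : Real.exp (-L) = δ := by
    rw [hLdef, one_div, Real.log_inv, neg_neg, Real.exp_log hδ]
  have hLm : L ≤ 12 * ε * m := by
    have h := hA.exp_neg_le hC hcard hε hε' hδ.le
    -- The right side is the square root of `δ`, so this is where `δ ≤ 1 / 4` enters.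
    have h3 : 2 * δ ≤ Real.exp (-L / 2) := by
      have h4 : Real.exp (-L / 2) * Real.exp (-L / 2) = δ := by
        rw [← Real.exp_add, ← h2]; congr 1; ring
      nlinarith [Real.exp_pos (-L / 2)]
    have := Real.exp_le_exp.1 (h.trans h3)
    linarith
  -- One shattered point serves as the heavy point, so only `n = d - 1` is bounded. For `n ≥ 1`, `n
  -- + 1 ≤ 2 * n`; for `d = 1` the bound follows from `1 ≤ L ≤ 12 * ε * m`.
  have hdm : (d : ℝ) ≤ 64 * ε * m := by
    rcases d with _ | n
    · simp; positivity
    · obtain ⟨x, hx⟩ := exists_shatters_of_vcDim_eq hd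
      have hn := hA.card_le_of_shatters hC hx hε hε' hδ.le hδ'
      push_cast
      rcases Nat.eq_zero_or_pos n with rfl | hpos
      · have : 0 ≤ ε * m := by positivity
        push_cast
        linarith
      · have : (1 : ℝ) ≤ n := by exact_mod_cast hpos
        linarith
  rw [one_div, inv_mul_le_iff₀ hε]
  linarith

theorem le_sampleComplexity (hC : ∀ h ∈ C, Measurable h) (hcard : 3 ≤ C.encard) {d : ℕ}
    (hd : vcDim C = d) {ε δ : ℝ} (hε : 0 < ε) (hε' : ε ≤ 1 / 8) (hδ : 0 < δ) (hδ' : δ ≤ 1 / 4) :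
    ENNReal.ofReal (1 / ε * (d + Log (1 / δ))) ≤
      ENNReal.ofReal 76 * (sampleComplexity.{u, v} C ε δ : ℝ≥0∞) := by
  set r := 1 / ε * (d + Log (1 / δ)) with hr
  have hle : ((⌈r / 76⌉₊ : ℕ) : ℕ∞) ≤ sampleComplexity.{u, v} C ε δ := by
    refine le_iInf₂ fun m ⟨A, hA⟩ => ?_
    have := hA.le_mul hC hcard hd hε hε' hδ hδ'
    exact_mod_cast Nat.ceil_le.2 (by linarith)
  calc ENNReal.ofReal r ≤ ENNReal.ofReal (76 * (⌈r / 76⌉₊ : ℝ)) := by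
        refine ENNReal.ofReal_le_ofReal ?_
        have := Nat.le_ceil (r / 76)
        linarith
    _ = ENNReal.ofReal 76 * ((⌈r / 76⌉₊ : ℕ∞) : ℝ≥0∞) := by
        rw [ENNReal.ofReal_mul (by norm_num)]
        simp
    _ ≤ _ := by
        gcongr

end SampleComplexity

end PACLearning

theorem corollary2 :
    ∃ ε₀ ∈ Ioo (0 : ℝ) 1, ∃ δ₀ ∈ Ioo (0 : ℝ) 1, ∃ c₀ ∈ Ioi (0 : ℝ),
      ∀ (X : Type u) [MeasurableSpace X] (C : Set (X → Bool)),
        (∀ h ∈ C, Measurable h) → 3 ≤ C.encard → PACLearning.MeasurableRealizability C →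
        ∀ d : ℕ, PACLearning.vcDim C = d →
        ∀ ε ∈ Ioo 0 ε₀, ∀ δ ∈ Ioo 0 δ₀,
          (PACLearning.sampleComplexity.{u, v} C ε δ : ℝ≥0∞) ≤
              ENNReal.ofReal (c₀ * (1 / ε * (d + PACLearning.Log (1 / δ)))) ∧
          ENNReal.ofReal (1 / ε * (d + PACLearning.Log (1 / δ))) ≤
              ENNReal.ofReal c₀ * (PACLearning.sampleComplexity.{u, v} C ε δ : ℝ≥0∞) := by
  -- `76 = 64 + 12` comes from the lower bound and exceeds the `33` of the upper bound.
  refine ⟨1 / 8, by norm_num, 1 / 16, by norm_num, 76, by norm_num, ?_⟩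
  intro X _ C hC hcard hr d hd ε ⟨hε, hε'⟩ δ ⟨hδ, hδ'⟩
  refine ⟨?_, PACLearning.le_sampleComplexity.{u, v} hC hcard hd hε hε'.le hδ (by linarith)⟩
  refine (PACLearning.sampleComplexity_le.{u, v} hC hr hd hε (by linarith) hδ
    (by linarith)).trans (ENNReal.ofReal_le_ofReal ?_)
  obtain ⟨hL, hL1⟩ := PACLearning.Log_one_div hδ (by linarith)
  have : 0 ≤ 1 / ε * (d + PACLearning.Log (1 / δ)) := by
    rw [hL]; positivity
  linarith
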